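/- **Conventions.** An *ordered groupoid* is a small groupoid $\mathcal G$ with a partial order on its set of arrows such that $a\le b$ implies $a^{-1}\le b^{-1}$; $a\le b$, $c\le d$ imply $ac\le bd$ whenever both composites exist; and, writing $A'\le A$ for $1_{A'}\le 1_A$, for every arrow $f\colon A\to B$ and object $A'\le A$ there is a unique arrow $f|_{A'}$ with domain $A'$ and $f|_{A'}\le f$. It is regarded as a double category: horizontal arrows are the arrows of the groupoid, vertical arrows are the relations $A'\le A$, double cells are the relations $f'\le f$. *Double functors* between ordered groupoids are thus the order-preserving functors. A category is *left-cancellative* if all its arrows are monomorphisms. For an ordered groupoid $\mathcal G$, let $\mathbf L(\mathcal G)$ be the left-cancellative category with the objects of $\mathcal G$, whose arrows $A\to B$ are formal composites $(h,\le)$ of an arrow $h\colon A\to B'$ of $\mathcal G$ and a relation $B'\le B$, with composition $(k,\le)\circ(h,\le)=(k|_{B'}\circ h,\le)$. For ordered groupoids $\mathcal G,\mathcal H$, the double category $\mathbf{DblCat}(\mathcal G,\mathcal H)$ of double functors, horizontal transformations, vertical transformations ($F\le F'$) and modifications is again an ordered groupoid. A *$\Lambda$-transformation* $F\Rightarrow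 K$ is an arrow of $\mathbf L(\mathbf{DblCat}(\mathcal G,\mathcal H))$, i.e. a horizontal transformation $\alpha\colon F\Rightarrow K'$ together with $K'\le K$. Let $\mathit{oGpd}$ be the 2-category of ordered groupoids, double functors and $\Lambda$-transformations (with vertical composition that of $\mathbf L(\mathbf{DblCat}(\mathcal G,\mathcal H))$ and componentwise whiskering), and let $\mathit{lcCat}$ be the full sub-2-category of $\mathbf{Cat}$ on the small left-cancellative categories. The 2-functor $\mathbf L\colon\mathit{oGpd}\to\mathit{lcCat}$ is $\mathcal G\mapsto\mathbf L(\mathcal G)$ on objects, $\mathbf L(F)(h,\le)=(F(h),\le)$ on double functors, and sends $(\alpha,\le)$ to the natural transformation with components $(\alpha_X,\le)$. The 2-functor $\mathbf G\colon\mathit{lcCat}\to\mathit{oGpd}$ is defined as follows. The objects of $\mathbf G(\mathcal C)$ are the subobjects $[m]$ in $\mathcal C$ (arrows $m\colon A\to B$ up to isomorphism of $A$ over $B$); its arrows $[m]\to[n]$ are the classes $[m,n]$ of spans $B\xleftarrow{m}A\xrightarrow{n}C$ up to isomorphism of the apex, composed by $[m,n]\circ[k,m]=[k,n]$; and $[m,n]\le[m',n']$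 iff there is $h$ with $m=m'h$, $n=n'h$. On functors, $\mathbf G(K)[m]=[Km]$ and $\mathbf G(K)[m,n]=[Km,Kn]$; for $\theta\colon K\Rightarrow K'$, the component of $\mathbf G(\theta)$ at $[m]$, where $m$ has domain $A$, is $[Km]\xrightarrow{[Km,\,K'm\circ\theta_A]}[K'm\circ\theta_A]\le[K'm]$. For a left-cancellative category $\mathcal C$ let $\eta_{\mathcal C}\colon\mathcal C\to\mathbf{LG}(\mathcal C)$ be the functor $A\mapsto[1_A]$, $(h\colon A\to B)\mapsto\bigl([1_A]\xrightarrow{[1_A,h]}[h]\le[1_B]\bigr)$. For an ordered groupoid $\mathcal H$ let $\kappa_{\mathcal H}\colon\mathbf{GL}(\mathcal H)\to\mathcal H$ be the double functor sending the subobject $[A\xrightarrow{h}B'\le B]$ to $B'$ and the arrow represented by the span with legs $A\xrightarrow{h}B'\le B$ and $A\xrightarrow{k}C'\le C$ to $k\circ h^{-1}\colon B'\to C'$. **Theorem.** The 2-functors $\mathbf G\colon\mathit{lcCat}\to\mathit{oGpd}$ and $\mathbf L\colon\mathit{oGpd}\to\mathit{lcCat}$ form a 2-adjunction, with $\mathbf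 G$ left adjoint to $\mathbf L$, whose unit and counit are $\eta$ and $\kappa$. That is, the $\eta_{\mathcal C}$ form a strict 2-natural transformation $\eta\colon\mathrm{Id}_{\mathit{lcCat}}\Rightarrow\mathbf{LG}$, the $\kappa_{\mathcal H}$ form a strict 2-natural transformation $\kappa\colon\mathbf{GL}\Rightarrow\mathrm{Id}_{\mathit{oGpd}}$ (all naturality squares commute on the nose, and naturality also holds for 2-cells), and the triangle identities $\kappa_{\mathbf G(\mathcal C)}\circ\mathbf G(\eta_{\mathcal C})=1_{\mathbf G(\mathcal C)}$ and $\mathbf L(\kappa_{\mathcal H})\circ\eta_{\mathbf L(\mathcal H)}=1_{\mathbf L(\mathcal H)}$ hold on the nose for all left-cancellative categories $\mathcal C$ and all ordered groupoids $\mathcal H$. -/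

import Mathlib

open CategoryTheory Bicategory

universe v u

namespace OrdGpd

/-! ### Ordered groupoids -/

/-- An ordered groupoid: a groupoid with a partial order on its arrows (`HomLE f g` is `f ≤ g`,
for arrows with arbitrary endpoints), compatible with inverses and composition, such that every
arrow `f : X ⟶ Y` has a unique restriction to each object `X' ≤ X`. The order on objects is the
order on identity arrows. -/
class OrderedGroupoid (C : Type u) extends Groupoid.{v} C where
  HomLE : ∀ {X Y X' Y' : C}, (X ⟶ Y) → (X' ⟶ Y') → Prop
  homLE_refl : ∀ {X Y : C} (f : X ⟶ Y), HomLE f f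
  homLE_trans : ∀ {X Y X' Y' X'' Y'' : C} {f : X ⟶ Y} {g : X' ⟶ Y'} {h : X'' ⟶ Y''},
    HomLE f g → HomLE g h → HomLE f h
  homLE_antisymm : ∀ {X Y X' Y' : C} {f : X ⟶ Y} {g : X' ⟶ Y'},
    HomLE f g → HomLE g f → (⟨X, Y, f⟩ : Σ A B : C, A ⟶ B) = ⟨X', Y', g⟩
  homLE_inv : ∀ {X Y X' Y' : C} {f : X ⟶ Y} {g : X' ⟶ Y'},
    HomLE f g → HomLE (Groupoid.inv f) (Groupoid.inv g)
  homLE_comp : ∀ {X Y Z X' Y' Z' : C} {f : X ⟶ Y} {g : X' ⟶ Y'} {h : Y ⟶ Z} {k : Y' ⟶ Z'},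
    HomLE f g → HomLE h k → HomLE (f ≫ h) (g ≫ k)
  existsUnique_restrict : ∀ {X Y : C} (f : X ⟶ Y) (X' : C), HomLE (𝟙 X') (𝟙 X) →
    ∃! g : Σ Y' : C, X' ⟶ Y', HomLE g.2 f

/-- The order relation on the arrows of an ordered groupoid, i.e. its double cells. -/
infix:50 " ⊑ " => OrderedGroupoid.HomLE

section Basic

variable {C : Type u} [OrderedGroupoid.{v} C]

/-- The order on objects, i.e. the vertical arrows of the associated double category. -/
def ObjLE (X Y : C) : Prop := OrderedGroupoid.HomLE (𝟙 X) (𝟙 Y)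

theorem le_refl {X Y : C} (f : X ⟶ Y) : f ⊑ f := OrderedGroupoid.homLE_refl f

theorem le_trans {X Y X' Y' X'' Y'' : C} {f : X ⟶ Y} {g : X' ⟶ Y'} {h : X'' ⟶ Y''}
    (a : f ⊑ g) (b : g ⊑ h) : f ⊑ h := OrderedGroupoid.homLE_trans a b

theorem le_inv {X Y X' Y' : C} {f : X ⟶ Y} {g : X' ⟶ Y'} (a : f ⊑ g) :
    Groupoid.inv f ⊑ Groupoid.inv g := OrderedGroupoid.homLE_inv a

theorem le_comp {X Y Z X' Y' Z' : C} {f : X ⟶ Y} {g : X' ⟶ Y'} {h : Y ⟶ Z} {k : Y' ⟶ Z'}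
    (a : f ⊑ g) (b : h ⊑ k) : f ≫ h ⊑ g ≫ k := OrderedGroupoid.homLE_comp a b

theorem le_dom {X Y X' Y' : C} {f : X ⟶ Y} {g : X' ⟶ Y'} (a : f ⊑ g) : ObjLE X X' := by
  simpa only [ObjLE, Groupoid.comp_inv] using le_comp a (le_inv a)

theorem le_cod {X Y X' Y' : C} {f : X ⟶ Y} {g : X' ⟶ Y'} (a : f ⊑ g) : ObjLE Y Y' := by
  simpa only [ObjLE, Groupoid.inv_comp] using le_comp (le_inv a) a

theorem ObjLE.refl (X : C) : ObjLE X X := le_refl _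

theorem ObjLE.trans {X Y Z : C} (a : ObjLE X Y) (b : ObjLE Y Z) : ObjLE X Z := le_trans a b

/-- The codomain of the restriction of `f : X ⟶ Y` to `X' ≤ X`. -/
noncomputable def resObj {X Y X' : C} (f : X ⟶ Y) (h : ObjLE X' X) : C :=
  (OrderedGroupoid.existsUnique_restrict f X' h).choose.1

/-- The restriction of `f : X ⟶ Y` to `X' ≤ X`. -/
noncomputable def res {X Y X' : C} (f : X ⟶ Y) (h : ObjLE X' X) : X' ⟶ resObj f h :=
  (OrderedGroupoid.existsUnique_restrict f X' h).choose.2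

theorem res_le {X Y X' : C} (f : X ⟶ Y) (h : ObjLE X' X) : res f h ⊑ f :=
  (OrderedGroupoid.existsUnique_restrict f X' h).choose_spec.1

theorem sigma_eq {X Y Y' Z W : C} {f : X ⟶ Y} {f' : X ⟶ Y'} {g : Z ⟶ W}
    (a : f ⊑ g) (b : f' ⊑ g) : (⟨Y, f⟩ : Σ B : C, X ⟶ B) = ⟨Y', f'⟩ :=
  (OrderedGroupoid.existsUnique_restrict g X (le_dom a)).unique a b

theorem le_of_le_of_le {X Y X' Y' Z W : C} {f : X ⟶ Y} {f' : X' ⟶ Y'} {g : Z ⟶ W}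
    (a : f ⊑ g) (b : f' ⊑ g) (h : ObjLE X X') : f ⊑ f' := by
  have := sigma_eq a (le_trans (res_le f' h) b)
  rw [Sigma.ext_iff] at this
  obtain ⟨h₁, h₂⟩ := this
  dsimp only at h₁ h₂
  have key : ∀ {Y₂ : C} (e : Y = Y₂) (k : X ⟶ Y₂), f ≍ k → k ⊑ f' → f ⊑ f' := by
    rintro _ rfl k hk hk'
    rwa [eq_of_heq hk]
  exact key h₁ _ h₂ (res_le f' h)

theorem le_symm {X Y Y' : C} {f : X ⟶ Y} {f' : X ⟶ Y'} (a : f ⊑ f') : f' ⊑ f :=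
  le_of_le_of_le (le_refl _) a (ObjLE.refl _)

theorem eq_of_le {X Y : C} {f f' : X ⟶ Y} (a : f ⊑ f') : f = f' :=
  eq_of_heq (Sigma.ext_iff.1 (sigma_eq a (le_refl f'))).2

theorem cod_eq_of_le {X Y Y' : C} {f : X ⟶ Y} {f' : X ⟶ Y'} (a : f ⊑ f') : Y = Y' :=
  (Sigma.ext_iff.1 (sigma_eq a (le_refl f'))).1

theorem le_symm_cod {X X' Y : C} {f : X ⟶ Y} {f' : X' ⟶ Y} (a : f ⊑ f') : f' ⊑ f := by
  simpa using le_inv (le_symm (le_inv a))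

theorem ObjLE.antisymm {X Y : C} (a : ObjLE X Y) (b : ObjLE Y X) : X = Y :=
  congrArg Sigma.fst (OrderedGroupoid.homLE_antisymm a b)

theorem le_eqToHom_comp {X X' Y : C} (e : X = X') (f : X' ⟶ Y) : f ⊑ eqToHom e ≫ f := by
  subst e; simpa using le_refl f

theorem le_comp_eqToHom {X Y Y' : C} (f : X ⟶ Y) (e : Y = Y') : f ⊑ f ≫ eqToHom e := by
  subst e; simpa using le_refl f

end Basic

/-! ### The left-cancellative category of an ordered groupoid -/

/-- The objects of the category `L(C)`: those of `C`. -/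
structure LCat (C : Type u) where
  as : C

/-- An arrow `A ⟶ B` of `L(C)`: a formal composite of a horizontal arrow `A ⟶ mid` and a
vertical arrow `mid ≤ B`. -/
structure LHom {C : Type u} [OrderedGroupoid.{v} C] (A B : C) where
  mid : C
  hor : A ⟶ mid
  mid_le : ObjLE mid B

section LCat

variable {C : Type u} [OrderedGroupoid.{v} C]

theorem LHom.ext_le {A B : C} {f g : LHom A B} (h : f.hor ⊑ g.hor) : f = g := by
  obtain ⟨m, f, hf⟩ := f
  obtain ⟨n, g, hg⟩ := g
  obtain rfl : m = n := cod_eq_of_le h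
  obtain rfl := eq_of_le h
  rfl

theorem LHom.le_of_eq {A B : C} {f g : LHom A B} (h : f = g) : f.hor ⊑ g.hor := by
  subst h; exact le_refl _

noncomputable instance : CategoryStruct (LCat C) where
  Hom A B := LHom A.as B.as
  id A := ⟨A.as, 𝟙 A.as, ObjLE.refl _⟩
  comp f g := ⟨resObj g.hor f.mid_le, f.hor ≫ res g.hor f.mid_le, (le_cod (res_le g.hor f.mid_le)).trans g.mid_le⟩

theorem LCat.hom_ext {A B : LCat C} {f g : A ⟶ B} (h : f.hor ⊑ g.hor) : f = g :=
  LHom.ext_le h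

theorem LCat.comp_hor {A B D : LCat C} (f : A ⟶ B) (g : B ⟶ D) :
    (f ≫ g).hor = f.hor ≫ res g.hor f.mid_le := rfl

theorem LCat.id_hor (A : LCat C) : (𝟙 A : A ⟶ A).hor = 𝟙 A.as := rfl

/-- The horizontal part of a composite, up to the choice of the restriction. -/
theorem LCat.comp_hor_le {A B D : LCat C} (f : A ⟶ B) (g : B ⟶ D) {Y : C} {k : f.mid ⟶ Y}
    (hk : k ⊑ g.hor) : (f ≫ g).hor ⊑ f.hor ≫ k :=
  le_comp (le_refl _) (le_of_le_of_le (res_le _ _) hk (ObjLE.refl _))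

noncomputable instance : Category (LCat C) where
  id_comp f := LCat.hom_ext (by
    rw [LCat.comp_hor, LCat.id_hor, Category.id_comp]; exact res_le _ _)
  comp_id {A B} f := LCat.hom_ext (by
    refine le_trans (LCat.comp_hor_le f (𝟙 B) (k := 𝟙 f.mid) f.mid_le) ?_
    rw [Category.comp_id]; exact le_refl _)
  assoc f g h := LCat.hom_ext (by
    rw [LCat.comp_hor, LCat.comp_hor, Category.assoc, LCat.comp_hor f]
    refine le_comp (le_refl _) (le_of_le_of_le ?_ (res_le (g ≫ h).hor f.mid_le) (ObjLE.refl _))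
    rw [LCat.comp_hor]
    exact le_comp (res_le _ _) (le_of_le_of_le (res_le _ _) (res_le _ _)
      (le_cod (res_le g.hor f.mid_le))))

end LCat

/-- A category is left-cancellative if all its arrows are monomorphisms. -/
class LeftCancellative (C : Type u) [Category.{v} C] : Prop where
  mono : ∀ {X Y : C} (f : X ⟶ Y), Mono f

instance (priority := 50) LeftCancellative.mono_of {C : Type u} [Category.{v} C]
    [LeftCancellative C] {X Y : C} (f : X ⟶ Y) : Mono f := LeftCancellative.mono f

instance {C : Type u} [OrderedGroupoid.{v} C] : LeftCancellative (LCat C) where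
  mono {X Y} k := ⟨fun {Z} f g h => by
    have h' := LHom.le_of_eq h
    rw [LCat.comp_hor, LCat.comp_hor] at h'
    have e : resObj k.hor f.mid_le = resObj k.hor g.mid_le := cod_eq_of_le h'
    have key : ∀ {Y₁ Y₂ : C} (_ : Y₁ = Y₂) (a : f.mid ⟶ Y₁) (b : g.mid ⟶ Y₂),
        a ⊑ k.hor → b ⊑ k.hor → f.hor ≫ a ⊑ g.hor ≫ b → f.hor ⊑ g.hor := by
      rintro Y₁ _ rfl a b ha hb hab
      have hab' : a ⊑ b := by
        simpa using le_inv (le_of_le_of_le (le_inv ha) (le_inv hb) (ObjLE.refl _))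
      simpa using le_comp hab (le_inv hab')
    exact LCat.hom_ext (key e _ _ (res_le _ _) (res_le _ _) h')⟩

/-! ### Double functors and their transformations -/

/-- A double functor between ordered groupoids, i.e. an ordered functor: a functor on horizontal
arrows which preserves vertical arrows (the order on objects) and double cells (the order on
arrows). Vertical arrows and double cells being unique, no further equations are needed. -/
structure DoubleFunctor (G : Type u) (H : Type u) [OrderedGroupoid.{v} G] [OrderedGroupoid.{v} H]
    extends G ⥤ H where
  map_vert : ∀ {X X' : G}, ObjLE X X' → ObjLE (obj X) (obj X')
  map_cell : ∀ {X Y X' Y' : G} {f : X ⟶ Y} {g : X' ⟶ Y'}, f ⊑ g → map f ⊑ map g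

section DblCat

variable {G : Type u} {H : Type u} [OrderedGroupoid.{v} G] [OrderedGroupoid.{v} H]

/-- A horizontal transformation of double functors. -/
@[ext]
structure HTrans (F K : DoubleFunctor G H) where
  app : ∀ X : G, F.obj X ⟶ K.obj X
  cell : ∀ {X X' : G}, ObjLE X X' → app X ⊑ app X'
  naturality : ∀ {X Y : G} (f : X ⟶ Y), F.map f ≫ app Y = app X ≫ K.map f

/-- A vertical transformation `F ≤ K` of double functors. -/
structure VTrans (F K : DoubleFunctor G H) : Prop where
  app : ∀ X : G, ObjLE (F.obj X) (K.obj X)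
  cell : ∀ {X Y : G} (f : X ⟶ Y), F.map f ⊑ K.map f

theorem VTrans.refl (F : DoubleFunctor G H) : VTrans F F :=
  ⟨fun _ => ObjLE.refl _, fun f => le_refl (F.map f)⟩

theorem VTrans.trans {F K M : DoubleFunctor G H} (a : VTrans F K) (b : VTrans K M) : VTrans F M :=
  ⟨fun X => (a.app X).trans (b.app X), fun f => le_trans (a.cell f) (b.cell f)⟩

theorem DoubleFunctor.ext_functor {F K : DoubleFunctor G H} (h : F.toFunctor = K.toFunctor) :
    F = K := by
  cases F; cases K; cases h; rfl

theorem DoubleFunctor.ext_le {F K : DoubleFunctor G H} (hobj : ∀ X, F.obj X = K.obj X)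
    (h : ∀ {X Y : G} (f : X ⟶ Y), F.map f ⊑ K.map f) : F = K := by
  refine DoubleFunctor.ext_functor (CategoryTheory.Functor.ext hobj fun X Y f => ?_)
  exact eq_of_le (le_trans (h f) (le_trans (le_comp_eqToHom _ _) (le_eqToHom_comp _ _)))

theorem VTrans.antisymm {F K : DoubleFunctor G H} (a : VTrans F K) (b : VTrans K F) : F = K :=
  DoubleFunctor.ext_le (fun X => (a.app X).antisymm (b.app X)) a.cell

/-- Horizontal transformations are the arrows of a groupoid. -/
instance DblCat.groupoid : Groupoid (DoubleFunctor G H) where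
  Hom F K := HTrans F K
  id F :=
    { app := fun X => 𝟙 (F.obj X)
      cell := F.map_vert
      naturality := by simp }
  comp a b :=
    { app := fun X => a.app X ≫ b.app X
      cell := fun h => le_comp (a.cell h) (b.cell h)
      naturality := fun f => by
        rw [← Category.assoc, a.naturality, Category.assoc, b.naturality, Category.assoc] }
  id_comp _ := HTrans.ext (funext fun _ => Category.id_comp _)
  comp_id _ := HTrans.ext (funext fun _ => Category.comp_id _)
  assoc _ _ _ := HTrans.ext (funext fun _ => Category.assoc _ _ _)
  inv a :=
    { app := fun X => Groupoid.inv (a.app X)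
      cell := fun h => le_inv (a.cell h)
      naturality := fun {X Y} f => by
        simp only [Groupoid.inv_eq_inv, IsIso.eq_inv_comp, ← Category.assoc, IsIso.comp_inv_eq]
        exact (a.naturality f).symm }
  inv_comp _ := HTrans.ext (funext fun _ => Groupoid.inv_comp _)
  comp_inv _ := HTrans.ext (funext fun _ => Groupoid.comp_inv _)

/-- The order on horizontal transformations. A double cell of the double category of double
functors is a modification, which amounts to a double cell `α_X ≤ β_X` for each object `X`, in a
frame whose vertical sides are vertical transformations. -/
structure Modif {F K F' K' : DoubleFunctor G H} (α : F ⟶ K) (β : F' ⟶ K') : Prop where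
  left : VTrans F F'
  right : VTrans K K'
  cell : ∀ X : G, α.app X ⊑ β.app X

theorem DblCat.map_eq {F K : DoubleFunctor G H} (α : F ⟶ K) {X Y : G} (f : X ⟶ Y) :
    K.map f = Groupoid.inv (α.app X) ≫ F.map f ≫ α.app Y := by
  rw [α.naturality, ← Category.assoc, Groupoid.inv_comp, Category.id_comp]

theorem Modif.mk' {F K F' K' : DoubleFunctor G H} {α : F ⟶ K} {β : F' ⟶ K'}
    (h : VTrans F F') (hc : ∀ X : G, α.app X ⊑ β.app X) : Modif α β :=
  ⟨h, ⟨fun X => le_cod (hc X), fun {X Y} f => by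
    rw [DblCat.map_eq α, DblCat.map_eq β]
    exact le_comp (le_inv (hc X)) (le_comp (h.cell f) (hc Y))⟩, hc⟩

/-- The restriction of a horizontal transformation along a vertical one: its codomain. -/
noncomputable def DblCat.resFunctor {F F' K : DoubleFunctor G H} (β : F' ⟶ K)
    (h : VTrans F F') : DoubleFunctor G H where
  obj X := resObj (β.app X) (h.app X)
  map {X Y} f := Groupoid.inv (res (β.app X) (h.app X)) ≫ F.map f ≫ res (β.app Y) (h.app Y)
  map_id X := by simp
  map_comp f g := by simp
  map_vert {X X'} hX := le_cod (le_of_le_of_le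
    (le_trans (res_le (β.app X) (h.app X)) (β.cell hX)) (res_le (β.app X') (h.app X'))
    (F.map_vert hX))
  map_cell {X Y X' Y' f g} hfg := by
    have key : ∀ {X X' : G}, ObjLE X X' →
        res (β.app X) (h.app X) ⊑ res (β.app X') (h.app X') := fun {X X'} hX =>
      le_of_le_of_le (le_trans (res_le (β.app X) (h.app X)) (β.cell hX))
        (res_le (β.app X') (h.app X')) (F.map_vert hX)
    exact le_comp (le_inv (key (le_dom hfg))) (le_comp (F.map_cell hfg) (key (le_cod hfg)))

/-- The restriction of a horizontal transformation along a vertical one. -/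
noncomputable def DblCat.resTrans {F F' K : DoubleFunctor G H} (β : F' ⟶ K)
    (h : VTrans F F') : F ⟶ DblCat.resFunctor β h where
  app X := res (β.app X) (h.app X)
  cell {X X'} hX := le_of_le_of_le (le_trans (res_le (β.app X) (h.app X)) (β.cell hX))
        (res_le (β.app X') (h.app X')) (F.map_vert hX)
  naturality f := by simp [DblCat.resFunctor]

theorem DblCat.sigma_eq {F F' K K' M : DoubleFunctor G H} {α : F ⟶ K} {α' : F ⟶ K'}
    {β : F' ⟶ M} (a : Modif α β) (b : Modif α' β) :
    (⟨K, α⟩ : Σ M : DoubleFunctor G H, F ⟶ M) = ⟨K', α'⟩ := by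
  have hc : ∀ X : G, α.app X ⊑ α'.app X := fun X =>
    le_of_le_of_le (a.cell X) (b.cell X) (.refl _)
  have e := Modif.mk' (VTrans.refl F) hc
  obtain rfl : K = K' := e.right.antisymm
    (Modif.mk' (VTrans.refl F) fun X => le_symm (hc X)).right
  obtain rfl : α = α' := HTrans.ext (funext fun X => eq_of_le (hc X))
  rfl

/-- The double category of double functors between two ordered groupoids, horizontal
transformations, vertical transformations and modifications, is an ordered groupoid. -/
instance DblCat.orderedGroupoid : OrderedGroupoid (DoubleFunctor G H) where
  HomLE α β := Modif α β
  homLE_refl _ := ⟨VTrans.refl _, VTrans.refl _, fun _ => le_refl _⟩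
  homLE_trans a b := ⟨a.left.trans b.left, a.right.trans b.right,
    fun X => le_trans (a.cell X) (b.cell X)⟩
  homLE_antisymm {F K F' K' α β} a b := by
    obtain rfl := a.left.antisymm b.left
    obtain rfl := a.right.antisymm b.right
    obtain rfl : α = β := HTrans.ext (funext fun X => eq_of_le (a.cell X))
    rfl
  homLE_inv a := ⟨a.right, a.left, fun X => le_inv (a.cell X)⟩
  homLE_comp a b := ⟨a.left, b.right, fun X => le_comp (a.cell X) (b.cell X)⟩
  existsUnique_restrict {F K} β F' h :=
    ⟨⟨DblCat.resFunctor β h.left, DblCat.resTrans β h.left⟩,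
      Modif.mk' h.left fun X => res_le (β.app X) (h.left.app X), fun _ hy => DblCat.sigma_eq hy
        (Modif.mk' h.left fun X => res_le (β.app X) (h.left.app X))⟩

theorem DblCat.objLE_iff {F K : DoubleFunctor G H} : ObjLE F K ↔ VTrans F K :=
  ⟨fun h => h.left, fun h => ⟨h, h, h.app⟩⟩

end DblCat

/-! ### The 2-category of ordered groupoids -/

/-- The functor `L(F) : L(G) ⥤ L(H)` induced by a double functor. -/
noncomputable def LFunctor {G H : Type u} [OrderedGroupoid.{v} G] [OrderedGroupoid.{v} H]
    (F : DoubleFunctor G H) : LCat G ⥤ LCat H where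
  obj A := ⟨F.obj A.as⟩
  map f := ⟨F.obj f.mid, F.map f.hor, F.map_vert f.mid_le⟩
  map_id A := LCat.hom_ext (by
    show F.map (𝟙 A.as) ⊑ 𝟙 (F.obj A.as)
    rw [F.map_id]; exact le_refl _)
  map_comp f g := LCat.hom_ext (by
    refine le_symm (le_trans (LCat.comp_hor_le _ _ (F.map_cell (res_le g.hor f.mid_le))) ?_)
    show F.map _ ≫ F.map _ ⊑ F.map (f.hor ≫ res g.hor f.mid_le)
    rw [F.map_comp]; exact le_refl _)

/-- A `Λ`-transformation `F ⇒ K`: an arrow of `L(DblCat(G, H))`, i.e. a formal composite of a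
horizontal transformation `F ⇒ K'` and a vertical transformation `K' ≤ K`. -/
abbrev LambdaTrans {G H : Type u} [OrderedGroupoid.{v} G] [OrderedGroupoid.{v} H]
    (F K : LCat (DoubleFunctor G H)) := F ⟶ K

section Lambda

variable {G H K : Type u} [OrderedGroupoid.{v} G] [OrderedGroupoid.{v} H] [OrderedGroupoid.{v} K]

namespace LambdaTrans

/-- The component at `X` of a `Λ`-transformation: an arrow of `L(H)`. -/
def app {F M : LCat (DoubleFunctor G H)} (α : LambdaTrans F M) (X : G) :
    (⟨F.as.obj X⟩ : LCat H) ⟶ ⟨M.as.obj X⟩ :=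
  ⟨α.mid.obj X, α.hor.app X, α.mid_le.left.app X⟩

theorem ext {F M : LCat (DoubleFunctor G H)} {α β : LambdaTrans F M}
    (h : ∀ X, α.app X = β.app X) : α = β :=
  LCat.hom_ext (Modif.mk' (VTrans.refl _) fun X => LHom.le_of_eq (h X))

theorem comp_app {F M N : LCat (DoubleFunctor G H)} (α : LambdaTrans F M) (β : LambdaTrans M N)
    (X : G) : LambdaTrans.app (α ≫ β) X = α.app X ≫ β.app X :=
  LCat.hom_ext (le_symm (LCat.comp_hor_le (α.app X) (β.app X)
    ((res_le β.hor α.mid_le).cell X)))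

theorem naturality {F M : LCat (DoubleFunctor G H)} (α : LambdaTrans F M) {A B : LCat G}
    (f : A ⟶ B) : (LFunctor F.as).map f ≫ α.app B.as = α.app A.as ≫ (LFunctor M.as).map f := by
  refine LCat.hom_ext ?_
  refine le_trans (LCat.comp_hor_le _ (α.app B.as) (α.hor.cell f.mid_le)) ?_
  refine le_trans ?_ (le_symm (LCat.comp_hor_le (α.app A.as) ((LFunctor M.as).map f)
    (α.mid_le.left.cell f.hor)))
  show F.as.map f.hor ≫ α.hor.app f.mid ⊑ α.hor.app A.as ≫ α.mid.map f.hor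
  rw [α.hor.naturality]
  exact le_refl _

end LambdaTrans

/-- The identity double functor. -/
def DoubleFunctor.id (G : Type u) [OrderedGroupoid.{v} G] : DoubleFunctor G G where
  toFunctor := 𝟭 G
  map_vert h := h
  map_cell h := h

/-- Composition of double functors. -/
def DoubleFunctor.comp (F : DoubleFunctor G H) (M : DoubleFunctor H K) : DoubleFunctor G K where
  toFunctor := F.toFunctor ⋙ M.toFunctor
  map_vert h := M.map_vert (F.map_vert h)
  map_cell h := M.map_cell (F.map_cell h)

/-- Whiskering `(α, ≤)F` of a `Λ`-transformation with a double functor applied first. -/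
def LambdaTrans.whiskerLeft (F : DoubleFunctor G H) {M N : LCat (DoubleFunctor H K)}
    (α : LambdaTrans M N) :
    LambdaTrans (⟨F.comp M.as⟩ : LCat (DoubleFunctor G K)) ⟨F.comp N.as⟩ where
  mid := F.comp α.mid
  hor :=
    { app := fun X => α.hor.app (F.obj X)
      cell := fun h => α.hor.cell (F.map_vert h)
      naturality := fun f => α.hor.naturality (F.map f) }
  mid_le := DblCat.objLE_iff.2
    ⟨fun X => α.mid_le.left.app (F.obj X), fun f => α.mid_le.left.cell (F.map f)⟩

/-- Whiskering `M(α, ≤)` of a `Λ`-transformation with a double functor applied last. -/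
def LambdaTrans.whiskerRight {F N : LCat (DoubleFunctor G H)} (α : LambdaTrans F N)
    (M : DoubleFunctor H K) :
    LambdaTrans (⟨F.as.comp M⟩ : LCat (DoubleFunctor G K)) ⟨N.as.comp M⟩ where
  mid := α.mid.comp M
  hor :=
    { app := fun X => M.map (α.hor.app X)
      cell := fun h => M.map_cell (α.hor.cell h)
      naturality := fun f => by
        show M.map (F.as.map f) ≫ M.map _ = M.map _ ≫ M.map (α.mid.map f)
        rw [← M.map_comp, α.hor.naturality, M.map_comp] }
  mid_le := DblCat.objLE_iff.2
    ⟨fun X => M.map_vert (α.mid_le.left.app X), fun f => M.map_cell (α.mid_le.left.cell f)⟩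

theorem LambdaTrans.whiskerRight_app {F N : LCat (DoubleFunctor G H)} (α : LambdaTrans F N)
    (M : DoubleFunctor H K) (X : G) :
    (LambdaTrans.whiskerRight α M).app X = (LFunctor M).map (α.app X) := rfl

theorem LambdaTrans.whisker_exchange {F N : LCat (DoubleFunctor G H)}
    {M P : LCat (DoubleFunctor H K)} (α : LambdaTrans F N) (β : LambdaTrans M P) :
    LambdaTrans.whiskerLeft F.as β ≫ LambdaTrans.whiskerRight α P.as =
      LambdaTrans.whiskerRight α M.as ≫ LambdaTrans.whiskerLeft N.as β :=
  LambdaTrans.ext fun X => by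
    rw [LambdaTrans.comp_app, LambdaTrans.comp_app]
    exact (β.naturality (α.app X)).symm

theorem LambdaTrans.whiskerLeft_comp (F : DoubleFunctor G H) {M N P : LCat (DoubleFunctor H K)}
    (α : LambdaTrans M N) (β : LambdaTrans N P) :
    LambdaTrans.whiskerLeft F (α ≫ β) =
      LambdaTrans.whiskerLeft F α ≫ LambdaTrans.whiskerLeft F β :=
  LambdaTrans.ext fun X => by
    rw [LambdaTrans.comp_app]
    exact LambdaTrans.comp_app α β (F.obj X)

theorem LambdaTrans.comp_whiskerRight {F N P : LCat (DoubleFunctor G H)} (α : LambdaTrans F N)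
    (β : LambdaTrans N P) (M : DoubleFunctor H K) :
    LambdaTrans.whiskerRight (α ≫ β) M =
      LambdaTrans.whiskerRight α M ≫ LambdaTrans.whiskerRight β M :=
  LambdaTrans.ext fun X => by
    rw [LambdaTrans.comp_app, LambdaTrans.whiskerRight_app, LambdaTrans.comp_app]
    exact (LFunctor M).map_comp _ _

theorem LambdaTrans.id_whiskerRight (F : LCat (DoubleFunctor G H)) (M : DoubleFunctor H K) :
    LambdaTrans.whiskerRight (𝟙 F) M = 𝟙 (⟨F.as.comp M⟩ : LCat (DoubleFunctor G K)) :=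
  LambdaTrans.ext fun X => (LFunctor M).map_id ⟨F.as.obj X⟩

end Lambda

/-- A (small) ordered groupoid, as an object of the 2-category of ordered groupoids. -/
structure OGpd : Type (u + 1) where
  carrier : Type u
  [str : OrderedGroupoid.{u} carrier]

attribute [instance] OGpd.str

/-- The 2-category of small ordered groupoids, double functors and `Λ`-transformations; the
category of arrows `G ⟶ H` is `L(DblCat(G, H))`. -/
noncomputable instance : Bicategory OGpd.{u} where
  Hom G H := LCat (DoubleFunctor G.carrier H.carrier)
  id G := ⟨DoubleFunctor.id G.carrier⟩
  comp F M := ⟨F.as.comp M.as⟩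
  homCategory G H := inferInstanceAs (Category (LCat (DoubleFunctor G.carrier H.carrier)))
  whiskerLeft F _ _ α := LambdaTrans.whiskerLeft F.as α
  whiskerRight α M := LambdaTrans.whiskerRight α M.as
  associator F M N := Iso.refl (⟨(F.as.comp M.as).comp N.as⟩ : LCat (DoubleFunctor _ _))
  leftUnitor F := Iso.refl F
  rightUnitor F := Iso.refl F
  whiskerLeft_id _ _ := rfl
  whiskerLeft_comp F _ _ _ α β := LambdaTrans.whiskerLeft_comp F.as α β
  id_whiskerLeft α := ((Category.id_comp _).trans (Category.comp_id (obj := LCat _) α)).symm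
  comp_whiskerLeft F M _ _ α := ((Category.id_comp _).trans (Category.comp_id (obj := LCat _)
    (LambdaTrans.whiskerLeft F.as (LambdaTrans.whiskerLeft M.as α)))).symm
  id_whiskerRight F M := LambdaTrans.id_whiskerRight F M.as
  comp_whiskerRight α β M := LambdaTrans.comp_whiskerRight α β M.as
  whiskerRight_id α := ((Category.id_comp _).trans (Category.comp_id (obj := LCat _) α)).symm
  whiskerRight_comp α M N := ((Category.id_comp _).trans (Category.comp_id (obj := LCat _)
    (LambdaTrans.whiskerRight (LambdaTrans.whiskerRight α M.as) N.as))).symm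
  whisker_assoc F _ _ α M := ((Category.id_comp _).trans (Category.comp_id (obj := LCat _)
    (LambdaTrans.whiskerLeft F.as (LambdaTrans.whiskerRight α M.as)))).symm
  whisker_exchange α β := LambdaTrans.whisker_exchange α β
  pentagon F M N P := by
    refine (congrArg₂ _ (LambdaTrans.id_whiskerRight _ _) rfl).trans ?_
    exact Category.id_comp (obj := LCat _) _
  triangle F M := by
    refine (Category.id_comp (obj := LCat _) _).trans ?_
    exact (LambdaTrans.id_whiskerRight F M.as).symm

instance : Bicategory.Strict OGpd.{u} where
  id_comp _ := rfl
  comp_id _ := rfl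
  assoc _ _ _ := rfl
  leftUnitor_eqToIso _ := rfl
  rightUnitor_eqToIso _ := rfl
  associator_eqToIso _ _ _ := rfl

/-! ### The 2-category of left-cancellative categories -/

/-- The 2-category of small left-cancellative categories: the full sub-2-category of `Cat` on the
left-cancellative categories. -/
abbrev LCCat : Type (u + 1) :=
  InducedBicategory Cat.{u, u} (Subtype.val : {C : Cat.{u, u} // LeftCancellative C} → Cat.{u, u})

/-- The object of `LCCat` given by a left-cancellative category. -/
abbrev LCCat.of (C : Type u) [Category.{u} C] [h : LeftCancellative C] : LCCat.{u} := ⟨Cat.of C, h⟩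

/-- The underlying category. -/
abbrev LCCat.cat (C : LCCat.{u}) : Cat.{u, u} := C.1

instance (C : LCCat.{u}) : LeftCancellative C.cat := C.2

/-- The 1-cell of `LCCat` given by a functor. -/
def LCCat.ofFunctor {C D : LCCat.{u}} (F : C.cat ⥤ D.cat) : C ⟶ D :=
  InducedBicategory.mkHom F.toCatHom

/-- The functor underlying a 1-cell of `LCCat`. -/
abbrev LCCat.functor {C D : LCCat.{u}} (F : C ⟶ D) : C.cat ⥤ D.cat := F.hom.toFunctor

/-- The natural transformation underlying a 2-cell of `LCCat`. -/
abbrev LCCat.natTrans {C D : LCCat.{u}} {F K : C ⟶ D} (θ : F ⟶ K) :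
    LCCat.functor F ⟶ LCCat.functor K := θ.hom.toNatTrans

/-- The 2-cell of `LCCat` given by a natural transformation. -/
def LCCat.ofNatTrans {C D : LCCat.{u}} {F K : C ⟶ D}
    (θ : LCCat.functor F ⟶ LCCat.functor K) : F ⟶ K :=
  InducedBicategory.Hom₂.mk (Cat.Hom₂.ofNatTrans θ)

theorem LCCat.hom_ext {C D : LCCat.{u}} {F K : C ⟶ D} (h : LCCat.functor F = LCCat.functor K) :
    F = K :=
  InducedBicategory.hom_ext (Cat.Hom.ext h)

theorem LCCat.hom₂_ext {C D : LCCat.{u}} {F K : C ⟶ D} {θ θ' : F ⟶ K}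
    (h : ∀ X, (LCCat.natTrans θ).app X = (LCCat.natTrans θ').app X) : θ = θ' :=
  InducedBicategory.hom₂_ext (Cat.Hom₂.ext (NatTrans.ext (funext h)))

/-! ### The 2-functor from ordered groupoids to left-cancellative categories -/

/-- The natural transformation `L(α, ≤)` with components `(α_X, ≤)`. -/
noncomputable def LNatTrans {G H : Type u} [OrderedGroupoid.{v} G] [OrderedGroupoid.{v} H]
    {F K : LCat (DoubleFunctor G H)} (α : LambdaTrans F K) : LFunctor F.as ⟶ LFunctor K.as where
  app A := α.app A.as
  naturality _ _ f := α.naturality f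

/-- The 2-functor `L`. -/
noncomputable def L : StrictPseudofunctor OGpd.{u} LCCat.{u} :=
  StrictPseudofunctor.mk''
    { obj := fun G => LCCat.of (LCat G.carrier)
      map := fun F => LCCat.ofFunctor (LFunctor F.as)
      map₂ := fun α => LCCat.ofNatTrans (LNatTrans α)
      map₂_id := fun _ => rfl
      map₂_comp := fun α β => LCCat.hom₂_ext fun X => LambdaTrans.comp_app α β X.as
      map_id := fun _ => rfl
      map_comp := fun _ _ => rfl
      map₂_whisker_left := fun _ _ _ _ =>
        ((Category.id_comp _).trans (Category.comp_id _)).symm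
      map₂_whisker_right := fun _ _ =>
        ((Category.id_comp _).trans (Category.comp_id _)).symm }

/-! ### The ordered groupoid of a left-cancellative category -/

section Span

variable {C : Type u} [Category.{v} C]

/-- A span `B ⟵ apex ⟶ D`. -/
structure PreSpan (B D : C) where
  apex : C
  left : apex ⟶ B
  right : apex ⟶ D

/-- Two spans are equivalent if they are isomorphic via an isomorphism of the apexes. -/
def PreSpan.setoid (B D : C) : Setoid (PreSpan B D) where
  r s t := ∃ i : s.apex ≅ t.apex, i.hom ≫ t.left = s.left ∧ i.hom ≫ t.right = s.right
  iseqv :=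
    { refl := fun s => ⟨Iso.refl _, by simp, by simp⟩
      symm := fun ⟨i, h₁, h₂⟩ => ⟨i.symm, by simp [← h₁], by simp [← h₂]⟩
      trans := fun ⟨i, h₁, h₂⟩ ⟨j, h₃, h₄⟩ =>
        ⟨i ≪≫ j, by simp [← h₁, ← h₃], by simp [← h₂, ← h₄]⟩ }

/-- Equivalence classes of spans. -/
def Span (B D : C) : Type max u v := Quotient (PreSpan.setoid B D)

/-- The equivalence class `[m, n]` of a span. -/
def Span.mk {A B D : C} (m : A ⟶ B) (n : A ⟶ D) : Span B D := Quotient.mk _ ⟨A, m, n⟩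

theorem Span.ind {B D : C} {P : Span B D → Prop}
    (h : ∀ (A : C) (m : A ⟶ B) (n : A ⟶ D), P (Span.mk m n)) (s : Span B D) : P s :=
  Quotient.ind (fun a => h a.apex a.left a.right) s

theorem Span.mk_eq_mk {A A' B D : C} {m : A ⟶ B} {n : A ⟶ D} {m' : A' ⟶ B} {n' : A' ⟶ D} :
    Span.mk m n = Span.mk m' n' ↔ ∃ i : A ≅ A', i.hom ≫ m' = m ∧ i.hom ≫ n' = n :=
  Quotient.eq (r := PreSpan.setoid B D)

/-- The span `[n, m]` opposite to `[m, n]`. -/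
def Span.swap {B D : C} (s : Span B D) : Span D B :=
  Quotient.map (sa := PreSpan.setoid B D) (sb := PreSpan.setoid D B)
    (fun a => ⟨a.apex, a.right, a.left⟩) (fun _ _ ⟨i, h₁, h₂⟩ => ⟨i, h₂, h₁⟩) s

/-- The order on spans with fixed feet: `[m, n] ≤ [m', n']` if there is an arrow `h` with
`m = m' ∘ h` and `n = n' ∘ h`. -/
def Span.LE {B D : C} (s t : Span B D) : Prop :=
  ∃ (A A' : C) (m : A ⟶ B) (n : A ⟶ D) (m' : A' ⟶ B) (n' : A' ⟶ D) (h : A ⟶ A'),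
    s = Span.mk m n ∧ t = Span.mk m' n' ∧ h ≫ m' = m ∧ h ≫ n' = n

theorem Span.mk_le_mk {A A' B D : C} {m : A ⟶ B} {n : A ⟶ D} {m' : A' ⟶ B} {n' : A' ⟶ D} :
    Span.LE (Span.mk m n) (Span.mk m' n') ↔ ∃ h : A ⟶ A', h ≫ m' = m ∧ h ≫ n' = n := by
  constructor
  · rintro ⟨E, E', p, q, p', q', h, hs, ht, h₁, h₂⟩
    obtain ⟨i, hi, hi'⟩ := Span.mk_eq_mk.1 hs
    obtain ⟨j, hj, hj'⟩ := Span.mk_eq_mk.1 ht.symm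
    exact ⟨i.hom ≫ h ≫ j.hom, by simp [hj, h₁, hi], by simp [hj', h₂, hi']⟩
  · rintro ⟨h, h₁, h₂⟩
    exact ⟨_, _, m, n, m', n', h, rfl, rfl, h₁, h₂⟩

/-- The order on spans with possibly different feet; comparable spans have the same feet. -/
inductive Span.HLE : ∀ {B D B' D' : C}, Span B D → Span B' D' → Prop
  | of_le {B D : C} {s t : Span B D} (h : Span.LE s t) : Span.HLE s t

theorem Span.HLE.elim {B D B' D' : C} {s : Span B D} {t : Span B' D'} (h : Span.HLE s t) :
    ∃ (hB : B = B') (hD : D = D'), Span.LE (hB ▸ hD ▸ s : Span B' D') t := by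
  cases h with
  | of_le h => exact ⟨rfl, rfl, h⟩

theorem Span.hle_iff {B D : C} {s t : Span B D} : Span.HLE s t ↔ Span.LE s t :=
  ⟨fun h => h.elim.choose_spec.choose_spec, fun h => .of_le h⟩

theorem Span.hle_refl {B D : C} (s : Span B D) : Span.HLE s s := by
  induction s using Span.ind with | _ A m n
  exact .of_le (Span.mk_le_mk.2 ⟨𝟙 _, by simp, by simp⟩)

theorem Span.hle_trans {B D B' D' B'' D'' : C} {r : Span B D} {s : Span B' D'} {t : Span B'' D''}
    (a : Span.HLE r s) (b : Span.HLE s t) : Span.HLE r t := by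
  obtain ⟨rfl, rfl, a⟩ := a.elim
  obtain ⟨rfl, rfl, b⟩ := b.elim
  refine Span.HLE.of_le ?_
  dsimp only at a b
  induction r using Span.ind with | _ A m n
  induction s using Span.ind with | _ A' m' n'
  induction t using Span.ind with | _ A'' m'' n''
  obtain ⟨i, rfl, rfl⟩ := Span.mk_le_mk.1 a
  obtain ⟨j, rfl, rfl⟩ := Span.mk_le_mk.1 b
  exact Span.mk_le_mk.2 ⟨i ≫ j, by simp, by simp⟩

theorem Span.hle_mk {A A' B D : C} {m : A ⟶ B} {n : A ⟶ D} {m' : A' ⟶ B} {n' : A' ⟶ D}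
    (h : A ⟶ A') (h₁ : h ≫ m' = m) (h₂ : h ≫ n' = n) :
    Span.HLE (Span.mk m n) (Span.mk m' n') :=
  .of_le (Span.mk_le_mk.2 ⟨h, h₁, h₂⟩)

/-- An inversion principle for the order on spans. -/
theorem Span.hle_cases {A A' B B' D D' : C} {m : A ⟶ B} {n : A ⟶ D} {m' : A' ⟶ B'} {n' : A' ⟶ D'}
    (h : Span.HLE (Span.mk m n) (Span.mk m' n')) : ∃ (_ : B = B') (_ : D = D') (i : A ⟶ A'),
      i ≫ m' ≍ m ∧ i ≫ n' ≍ n := by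
  obtain ⟨rfl, rfl, h⟩ := h.elim
  obtain ⟨i, rfl, rfl⟩ := Span.mk_le_mk.1 h
  exact ⟨rfl, rfl, i, HEq.rfl, HEq.rfl⟩

variable [LeftCancellative C]

/-- The subobject `[m]` determined by a span `[m, n]`. -/
def Span.left {B D : C} (s : Span B D) : Subobject B :=
  Quotient.lift (s := PreSpan.setoid B D) (fun a => Subobject.mk a.left)
    (fun _ _ ⟨i, h, _⟩ => Subobject.mk_eq_mk_of_comm _ _ i h) s

/-- The subobject `[n]` determined by a span `[m, n]`. -/
def Span.right {B D : C} (s : Span B D) : Subobject D := s.swap.left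

/-- The span `[m, m]` determined by a subobject `[m]`. -/
def Span.diag {B : C} (p : Subobject B) : Span B B :=
  Subobject.lift (fun _ m _ => Span.mk m m)
    (fun _ _ _ _ _ _ i h => Span.mk_eq_mk.2 ⟨i, h, h⟩) p

theorem mk_eq_mk_iff {A A' B : C} {m : A ⟶ B} {m' : A' ⟶ B} :
    Subobject.mk m = Subobject.mk m' ↔ ∃ i : A ≅ A', i.hom ≫ m' = m :=
  ⟨fun h => ⟨Subobject.isoOfMkEqMk m m' h, by simp⟩,
    fun ⟨i, h⟩ => Subobject.mk_eq_mk_of_comm _ _ i h⟩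

theorem Span.exists_comp {B D E : C} (s : Span B D) (t : Span D E) (h : s.right = t.left) :
    ∃! r : Span B E, ∃ (A A' : C) (k : A ⟶ B) (m : A ⟶ D) (m' : A' ⟶ D) (n : A' ⟶ E) (i : A ≅ A'),
      s = Span.mk k m ∧ t = Span.mk m' n ∧ i.hom ≫ m' = m ∧ r = Span.mk k (i.hom ≫ n) := by
  induction s using Span.ind with | _ A k m
  induction t using Span.ind with | _ A' m' n
  obtain ⟨i, hi⟩ := mk_eq_mk_iff.1 h
  refine ⟨Span.mk k (i.hom ≫ n), ⟨A, A', k, m, m', n, i, rfl, rfl, hi, rfl⟩, ?_⟩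
  rintro _ ⟨F, F', p, q, q', r, j, hs, ht, hj, rfl⟩
  obtain ⟨a, ha, ha'⟩ := Span.mk_eq_mk.1 hs
  obtain ⟨b, hb, hb'⟩ := Span.mk_eq_mk.1 ht
  refine (Span.mk_eq_mk.2 ⟨a, ha, ?_⟩).symm
  have : a.hom ≫ j.hom = i.hom ≫ b.hom := by
    rw [← cancel_mono q', Category.assoc, Category.assoc, hj, hb, ha', hi]
  rw [← Category.assoc, this, Category.assoc, hb']

/-- The composite of `[k, m]` and `[m', n]` when `[m] = [m']`: it is `[k, n ∘ i]`, where `i` is the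
isomorphism with `m' ∘ i = m`. -/
noncomputable def Span.comp {B D E : C} (s : Span B D) (t : Span D E) (h : s.right = t.left) :
    Span B E := (Span.exists_comp s t h).choose

theorem Span.comp_mk {A A' B D E : C} {k : A ⟶ B} {m : A ⟶ D} {m' : A' ⟶ D} {n : A' ⟶ E}
    (i : A ≅ A') (hi : i.hom ≫ m' = m) (h : (Span.mk k m).right = (Span.mk m' n).left) :
    Span.comp (Span.mk k m) (Span.mk m' n) h = Span.mk k (i.hom ≫ n) :=
  ((Span.exists_comp _ _ h).choose_spec.2 _ ⟨_, _, _, _, _, _, i, rfl, rfl, hi, rfl⟩).symm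

end Span

/-- The objects of `G(C)`: subobjects in `C`. -/
structure GObj (C : Type u) [Category.{v} C] where
  base : C
  sub : Subobject base

/-- The horizontal arrows `[m] ⟶ [n]` of `G(C)`: the classes of spans `[m, n]`. -/
@[ext]
structure GHom {C : Type u} [Category.{v} C] [LeftCancellative C] (p q : GObj C) where
  span : Span p.base q.base
  left_eq : span.left = p.sub
  right_eq : span.right = q.sub

section GObj

variable {C : Type u} [Category.{v} C] [LeftCancellative C]

/-- The object `[m]` of `G(C)`. -/
def GObj.mk' {A B : C} (m : A ⟶ B) : GObj C := ⟨B, Subobject.mk m⟩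

/-- The horizontal arrow `[m, n] : [m] ⟶ [n]` of `G(C)`. -/
def GHom.mk' {A B D : C} (m : A ⟶ B) (n : A ⟶ D) : GHom (GObj.mk' m) (GObj.mk' n) :=
  ⟨Span.mk m n, rfl, rfl⟩

theorem GObj.ind {P : GObj C → Prop} (h : ∀ {A B : C} (m : A ⟶ B), P (GObj.mk' m)) (p : GObj C) :
    P p := by
  obtain ⟨B, p⟩ := p
  induction p using Subobject.ind with | _ m
  exact h m

theorem GHom.ind {P : ∀ {p q : GObj C}, GHom p q → Prop}
    (h : ∀ {A B D : C} (m : A ⟶ B) (n : A ⟶ D), P (GHom.mk' m n)) {p q : GObj C} (f : GHom p q) :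
    P f := by
  obtain ⟨B, p⟩ := p
  obtain ⟨D, q⟩ := q
  obtain ⟨s, hl, hr⟩ := f
  have key : ∀ (s : Span B D) (hl : s.left = p) (hr : s.right = q),
      P (p := ⟨B, p⟩) (q := ⟨D, q⟩) ⟨s, hl, hr⟩ := by
    rintro t rfl rfl
    exact Span.ind (P := fun t => P (p := ⟨B, t.left⟩) (q := ⟨D, t.right⟩) ⟨t, rfl, rfl⟩)
      (fun _ m n => h m n) t
  exact key s hl hr

/-- Every horizontal arrow out of `[m]` is of the form `[m, n]`. -/
theorem GHom.ind_left {A B : C} (m : A ⟶ B) {P : ∀ {q : GObj C}, GHom (GObj.mk' m) q → Prop}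
    (h : ∀ {D : C} (n : A ⟶ D), P (GHom.mk' m n)) {q : GObj C} (f : GHom (GObj.mk' m) q) :
    P f := by
  obtain ⟨D, q⟩ := q
  obtain ⟨s, hs, hr⟩ := f
  have key : ∀ (s : Span B D) (hl : s.left = Subobject.mk m) (hr : s.right = q),
      P (q := ⟨D, q⟩) ⟨s, hl, hr⟩ := by
    rintro t hl rfl
    have e : ∃ n : A ⟶ D, t = Span.mk m n := by
      revert hl
      refine Span.ind (P := fun t => t.left = Subobject.mk m → ∃ n : A ⟶ D, t = Span.mk m n)
        (fun A' m' n hl => ?_) t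
      obtain ⟨i, hi⟩ := mk_eq_mk_iff.1 hl.symm
      exact ⟨i.hom ≫ n, Span.mk_eq_mk.2 ⟨i.symm, by simp [← hi], by simp⟩⟩
    obtain ⟨n, rfl⟩ := e
    exact h n
  exact key s hs hr

theorem GHom.comp_aux {p q r : GObj C} (f : GHom p q) (g : GHom q r) :
    (Span.comp f.span g.span (f.right_eq.trans g.left_eq.symm)).left = p.sub ∧
      (Span.comp f.span g.span (f.right_eq.trans g.left_eq.symm)).right = r.sub := by
  refine GHom.ind (P := fun {p q} f => ∀ g : GHom q r,
    (Span.comp f.span g.span (f.right_eq.trans g.left_eq.symm)).left = p.sub ∧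
      (Span.comp f.span g.span (f.right_eq.trans g.left_eq.symm)).right = r.sub) ?_ f g
  intro A B D k m g
  refine GHom.ind_left m (P := fun {r} g =>
    (Span.comp (GHom.mk' k m).span g.span (g.left_eq.symm)).left = Subobject.mk k ∧
      (Span.comp (GHom.mk' k m).span g.span (g.left_eq.symm)).right = r.sub) ?_ g
  intro E n
  have : Span.comp (GHom.mk' k m).span (GHom.mk' m n).span rfl = Span.mk k ((Iso.refl A).hom ≫ n) :=
    Span.comp_mk (k := k) (m := m) (m' := m) (n := n) (Iso.refl A) (by simp) rfl
  rw [this, Iso.refl_hom, Category.id_comp]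
  exact ⟨rfl, rfl⟩

noncomputable instance : CategoryStruct (GObj C) where
  Hom p q := GHom p q
  id p := ⟨Span.diag p.sub, by
      induction p using GObj.ind with | _ m
      rfl, by
      induction p using GObj.ind with | _ m
      rfl⟩
  comp f g := ⟨Span.comp f.span g.span (f.right_eq.trans g.left_eq.symm),
    (GHom.comp_aux f g).1, (GHom.comp_aux f g).2⟩

/-- The arrow `[m, n]` of `G(C)`. -/
def GObj.hom {A B D : C} (m : A ⟶ B) (n : A ⟶ D) : GObj.mk' m ⟶ GObj.mk' n := GHom.mk' m n

theorem GObj.hom_comp {A B D E : C} (k : A ⟶ B) (m : A ⟶ D) (n : A ⟶ E) :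
    GObj.hom k m ≫ GObj.hom m n = GObj.hom k n := by
  refine GHom.ext ((Span.comp_mk (k := k) (m := m) (m' := m) (n := n)
    (Iso.refl A) (by simp) rfl).trans ?_)
  rw [Iso.refl_hom, Category.id_comp]
  rfl

theorem GObj.id_mk' {A B : C} (m : A ⟶ B) : 𝟙 (GObj.mk' m) = GObj.hom m m := rfl

theorem GObj.hom_ind {P : ∀ {p q : GObj C}, (p ⟶ q) → Prop}
    (h : ∀ {A B D : C} (m : A ⟶ B) (n : A ⟶ D), P (GObj.hom m n)) {p q : GObj C} (f : p ⟶ q) :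
    P f := GHom.ind (P := fun f => P f) h f

/-- The inverse `[n, m]` of `[m, n]`. -/
def GHom.inv {p q : GObj C} (f : GHom p q) : GHom q p :=
  ⟨f.span.swap, f.right_eq, by
    obtain ⟨s, h, h'⟩ := f
    rw [← h]
    induction s using Span.ind with | _ A m n
    rfl⟩

noncomputable instance : Groupoid (GObj C) where
  id_comp {p q} f := by
    refine GObj.hom_ind (P := fun {p q} f => 𝟙 p ≫ f = f) (fun m n => ?_) f
    rw [GObj.id_mk', GObj.hom_comp]
  comp_id {p q} f := by
    refine GObj.hom_ind (P := fun {p q} f => f ≫ 𝟙 q = f) (fun m n => ?_) f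
    rw [GObj.id_mk', GObj.hom_comp]
  assoc {p q r s} f g h := by
    refine GObj.hom_ind (P := fun {p q} f => ∀ (g : q ⟶ r), (f ≫ g) ≫ h = f ≫ g ≫ h) ?_ f g
    intro A B D k m g
    refine GHom.ind_left m (P := fun {r} (g : GObj.mk' m ⟶ r) => ∀ (h : r ⟶ s),
      (GObj.hom k m ≫ g) ≫ h = GObj.hom k m ≫ g ≫ h) ?_ g h
    intro E n h
    refine GHom.ind_left n (P := fun {s} (h : GObj.mk' n ⟶ s) =>
      (GObj.hom k m ≫ GObj.hom m n) ≫ h = GObj.hom k m ≫ GObj.hom m n ≫ h) ?_ h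
    intro F l
    show (GObj.hom k m ≫ GObj.hom m n) ≫ GObj.hom n l = GObj.hom k m ≫ GObj.hom m n ≫ GObj.hom n l
    simp only [GObj.hom_comp]
  inv f := GHom.inv f
  inv_comp {p q} f := by
    refine GObj.hom_ind (P := fun {p q} f => (GHom.inv f : q ⟶ p) ≫ f = 𝟙 q) (fun m n => ?_) f
    exact GObj.hom_comp n m n
  comp_inv {p q} f := by
    refine GObj.hom_ind (P := fun {p q} f => f ≫ (GHom.inv f : q ⟶ p) = 𝟙 p) (fun m n => ?_) f
    exact GObj.hom_comp m n m

theorem GObj.sigma_eq {A A' B D : C} {m : A ⟶ B} {n : A ⟶ D} {m' : A' ⟶ B} {n' : A' ⟶ D}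
    (i : A ≅ A') (h : i.hom ≫ m' = m) (h' : i.hom ≫ n' = n) :
    (⟨GObj.mk' m, GObj.mk' n, GObj.hom m n⟩ : Σ p q : GObj C, p ⟶ q) =
      ⟨GObj.mk' m', GObj.mk' n', GObj.hom m' n'⟩ := by
  have key : ∀ s t : Span B D, s = t →
    (⟨⟨B, s.left⟩, ⟨D, s.right⟩, (⟨s, rfl, rfl⟩ : GHom _ _)⟩ : Σ p q : GObj C, p ⟶ q) =
      ⟨⟨B, t.left⟩, ⟨D, t.right⟩, (⟨t, rfl, rfl⟩ : GHom _ _)⟩ := by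
    rintro s _ rfl; rfl
  exact key _ _ (Span.mk_eq_mk.2 ⟨i, h, h'⟩)

theorem GObj.hle_antisymm {p q p' q' : GObj C} {f : p ⟶ q} {g : p' ⟶ q'}
    (a : Span.HLE f.span g.span) (b : Span.HLE g.span f.span) :
    (⟨p, q, f⟩ : Σ p q : GObj C, p ⟶ q) = ⟨p', q', g⟩ := by
  refine GObj.hom_ind (P := fun {p q} f => ∀ {p' q' : GObj C} (g : p' ⟶ q'),
    Span.HLE f.span g.span → Span.HLE g.span f.span →
    (⟨p, q, f⟩ : Σ p q : GObj C, p ⟶ q) = ⟨p', q', g⟩) ?_ f g a b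
  intro A B D m n p' q' g a b
  refine GObj.hom_ind (P := fun {p' q'} g =>
    Span.HLE (GObj.hom m n).span g.span → Span.HLE g.span (GObj.hom m n).span →
    (⟨_, _, GObj.hom m n⟩ : Σ p q : GObj C, p ⟶ q) = ⟨p', q', g⟩) ?_ g a b
  intro A' B' D' m' n' a b
  obtain ⟨rfl, rfl, i, h, h'⟩ := Span.hle_cases (m := m) (n := n) (m' := m') (n' := n') a
  obtain ⟨_, _, j, k, k'⟩ := Span.hle_cases (m := m') (n := n') (m' := m) (n' := n) b
  rw [heq_iff_eq] at h h' k k'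
  exact GObj.sigma_eq ⟨i, j, by rw [← cancel_mono m, Category.assoc, k, h, Category.id_comp],
    by rw [← cancel_mono m', Category.assoc, h, k, Category.id_comp]⟩ h h'

theorem Span.hle_swap {B D B' D' : C} {s : Span B D} {t : Span B' D'} (h : Span.HLE s t) :
    Span.HLE s.swap t.swap := by
  obtain ⟨rfl, rfl, h⟩ := h.elim
  obtain ⟨A, A', m, n, m', n', i, rfl, rfl, h₁, h₂⟩ := h
  exact Span.hle_mk i h₂ h₁

theorem GObj.hle_comp {X Y Z X' Y' Z' : GObj C} {f : X ⟶ Y} {g : X' ⟶ Y'} {h : Y ⟶ Z}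
    {k : Y' ⟶ Z'} (a : Span.HLE f.span g.span) (b : Span.HLE h.span k.span) :
    Span.HLE (f ≫ h).span (g ≫ k).span := by
  refine GObj.hom_ind (P := fun {X Y} f => ∀ {Z : GObj C} (h : Y ⟶ Z), Span.HLE f.span g.span →
    Span.HLE h.span k.span → Span.HLE (f ≫ h).span (g ≫ k).span) ?_ f h a b
  intro A B D m n Z h
  refine GHom.ind_left n (P := fun {Z} (h : GObj.mk' n ⟶ Z) =>
    Span.HLE (GObj.hom m n).span g.span →
    Span.HLE h.span k.span → Span.HLE (GObj.hom m n ≫ h).span (g ≫ k).span) ?_ h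
  intro E p
  refine GObj.hom_ind (P := fun {X' Y'} g => ∀ {Z' : GObj C} (k : Y' ⟶ Z'),
    Span.HLE (GObj.hom m n).span g.span → Span.HLE (GObj.hom n p).span k.span →
      Span.HLE (GObj.hom m n ≫ GObj.hom n p).span (g ≫ k).span) ?_ g k
  intro A' B' D' m' n' Z' k
  refine GHom.ind_left n' (P := fun {Z'} (k : GObj.mk' n' ⟶ Z') =>
    Span.HLE (GObj.hom m n).span (GObj.hom m' n').span → Span.HLE (GObj.hom n p).span k.span →
      Span.HLE (GObj.hom m n ≫ GObj.hom n p).span (GObj.hom m' n' ≫ k).span) ?_ k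
  intro E' p' a b
  obtain ⟨rfl, rfl, i, h₁, h₂⟩ := Span.hle_cases (m := m) (n := n) (m' := m') (n' := n') a
  obtain ⟨_, rfl, j, h₃, h₄⟩ := Span.hle_cases (m := n) (n := p) (m' := n') (n' := p') b
  rw [heq_iff_eq] at h₁ h₂ h₃ h₄
  obtain rfl : i = j := by rw [← cancel_mono n', h₂, h₃]
  have : Span.HLE (GObj.hom m p).span (GObj.hom m' p').span := Span.hle_mk i h₁ h₄
  show Span.HLE (GObj.hom m n ≫ GObj.hom n p).span (GObj.hom m' n' ≫ GObj.hom n' p').span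
  rwa [GObj.hom_comp, GObj.hom_comp]

theorem GObj.existsUnique_restrict {X Y : GObj C} (f : X ⟶ Y) (X' : GObj C)
    (h : Span.HLE (Span.diag X'.sub) (Span.diag X.sub)) :
    ∃! g : Σ Y' : GObj C, X' ⟶ Y', Span.HLE g.2.span f.span := by
  refine GObj.hom_ind (P := fun {X Y} f => Span.HLE (Span.diag X'.sub) (Span.diag X.sub) →
    ∃! g : Σ Y' : GObj C, X' ⟶ Y', Span.HLE g.2.span f.span) ?_ f h
  intro A B D m n
  induction X' using GObj.ind with | _ k
  rename_i A' B'
  intro h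
  obtain ⟨rfl, _, i, h, _⟩ := Span.hle_cases (m := k) (n := k) (m' := m) (n' := m) h
  obtain rfl := eq_of_heq h
  refine ⟨⟨GObj.mk' (i ≫ n), GObj.hom (i ≫ m) (i ≫ n)⟩, Span.hle_mk i rfl rfl, ?_⟩
  rintro ⟨Y', g⟩
  refine GHom.ind_left (i ≫ m) (P := fun {Y'} (g : GObj.mk' (i ≫ m) ⟶ Y') =>
    Span.HLE g.span (GObj.hom m n).span →
      (⟨Y', g⟩ : Σ Y' : GObj C, GObj.mk' (i ≫ m) ⟶ Y') = ⟨_, GObj.hom (i ≫ m) (i ≫ n)⟩) ?_ g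
  intro D' n' h
  obtain ⟨_, rfl, j, h₁, h₂⟩ :=
    Span.hle_cases (m := i ≫ m) (n := n') (m' := m) (n' := n) h
  rw [heq_iff_eq] at h₁ h₂
  obtain rfl := (cancel_mono m).1 h₁
  subst h₂
  rfl

/-- The ordered groupoid `G(C)` of a left-cancellative category. -/
noncomputable instance : OrderedGroupoid (GObj C) where
  HomLE f g := Span.HLE f.span g.span
  homLE_refl f := Span.hle_refl f.span
  homLE_trans a b := Span.hle_trans a b
  homLE_antisymm a b := GObj.hle_antisymm a b
  homLE_inv a := Span.hle_swap a
  homLE_comp a b := GObj.hle_comp a b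
  existsUnique_restrict f X' h := GObj.existsUnique_restrict f X' h

end GObj

/-! ### The 2-functor from left-cancellative categories to ordered groupoids -/

section GFunctor

variable {C D : Type u} [Category.{v} C] [Category.{v} D]

/-- An assignment on arrows, compatible with precomposition, induces a map on spans. -/
def Span.map {F : C ⥤ D} {o : C → D} (φ : ∀ {A B : C}, (A ⟶ B) → (F.obj A ⟶ o B))
    (hφ : ∀ {A A' B : C} (h : A ⟶ A') (m : A' ⟶ B), φ (h ≫ m) = F.map h ≫ φ m) {B E : C}
    (s : Span B E) : Span (o B) (o E) :=
  Quotient.map (sa := PreSpan.setoid B E) (sb := PreSpan.setoid (o B) (o E))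
    (fun a => ⟨F.obj a.apex, φ a.left, φ a.right⟩)
    (fun _ _ ⟨i, h₁, h₂⟩ => ⟨F.mapIso i, by simp [← hφ, h₁], by simp [← hφ, h₂]⟩) s

theorem Span.hle_map {F : C ⥤ D} {o : C → D} (φ : ∀ {A B : C}, (A ⟶ B) → (F.obj A ⟶ o B))
    (hφ : ∀ {A A' B : C} (h : A ⟶ A') (m : A' ⟶ B), φ (h ≫ m) = F.map h ≫ φ m) {B E B' E' : C}
    {s : Span B E} {t : Span B' E'} (h : Span.HLE s t) :
    Span.HLE (Span.map φ hφ s) (Span.map φ hφ t) := by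
  obtain ⟨rfl, rfl, h⟩ := h.elim
  obtain ⟨A, A', m, n, m', n', i, rfl, rfl, h₁, h₂⟩ := h
  exact Span.hle_mk (F.map i) (by simp [← hφ, h₁]) (by simp [← hφ, h₂])

variable [LeftCancellative C] [LeftCancellative D]

/-- An assignment on arrows, compatible with precomposition, induces a map on subobjects. -/
def GObj.map {F : C ⥤ D} {o : C → D} (φ : ∀ {A B : C}, (A ⟶ B) → (F.obj A ⟶ o B))
    (hφ : ∀ {A A' B : C} (h : A ⟶ A') (m : A' ⟶ B), φ (h ≫ m) = F.map h ≫ φ m)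
    (p : GObj C) : GObj D :=
  ⟨o p.base, Subobject.lift (fun _ m _ => Subobject.mk (φ m))
    (fun _ _ _ _ _ _ i h => mk_eq_mk_iff.2 ⟨F.mapIso i, by simp [← hφ, h]⟩) p.sub⟩

/-- An assignment on arrows, compatible with precomposition, induces a map on horizontal arrows. -/
def GHom.map {F : C ⥤ D} {o : C → D} (φ : ∀ {A B : C}, (A ⟶ B) → (F.obj A ⟶ o B))
    (hφ : ∀ {A A' B : C} (h : A ⟶ A') (m : A' ⟶ B), φ (h ≫ m) = F.map h ≫ φ m)
    {p q : GObj C} (f : p ⟶ q) : GObj.map φ hφ p ⟶ GObj.map φ hφ q :=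
  GHom.mk (Span.map φ hφ f.span)
    (GHom.ind (P := fun {p q} f => (Span.map φ hφ f.span).left = (GObj.map φ hφ p).sub)
      (fun _ _ => rfl) f)
    (GHom.ind (P := fun {p q} f => (Span.map φ hφ f.span).right = (GObj.map φ hφ q).sub)
      (fun _ _ => rfl) f)

theorem GHom.map_comp {F : C ⥤ D} {o : C → D} (φ : ∀ {A B : C}, (A ⟶ B) → (F.obj A ⟶ o B))
    (hφ : ∀ {A A' B : C} (h : A ⟶ A') (m : A' ⟶ B), φ (h ≫ m) = F.map h ≫ φ m)
    {p q r : GObj C} (f : p ⟶ q) (g : q ⟶ r) :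
    GHom.map φ hφ (f ≫ g) = GHom.map φ hφ f ≫ GHom.map φ hφ g := by
  refine GObj.hom_ind (P := fun {p q} f => ∀ g : q ⟶ r,
    GHom.map φ hφ (f ≫ g) = GHom.map φ hφ f ≫ GHom.map φ hφ g) ?_ f g
  intro A B E k m g
  refine GHom.ind_left m (P := fun {r} (g : GObj.mk' m ⟶ r) =>
    GHom.map φ hφ (GObj.hom k m ≫ g) = GHom.map φ hφ (GObj.hom k m) ≫ GHom.map φ hφ g) ?_ g
  intro E n
  show GHom.map φ hφ (GObj.hom k m ≫ GObj.hom m n) = GObj.hom (φ k) (φ m) ≫ GObj.hom (φ m) (φ n)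
  rw [GObj.hom_comp, GObj.hom_comp]
  rfl

/-- An assignment `φ` on arrows, compatible with precomposition, induces a double functor
`[m] ↦ [φ m]`, `[m, n] ↦ [φ m, φ n]`. -/
noncomputable def GObj.mapDoubleFunctor {F : C ⥤ D} {o : C → D}
    (φ : ∀ {A B : C}, (A ⟶ B) → (F.obj A ⟶ o B))
    (hφ : ∀ {A A' B : C} (h : A ⟶ A') (m : A' ⟶ B), φ (h ≫ m) = F.map h ≫ φ m) :
    DoubleFunctor (GObj C) (GObj D) where
  obj := GObj.map φ hφ
  map := GHom.map φ hφ
  map_id p := by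
    induction p using GObj.ind with | _ m
    rfl
  map_comp := GHom.map_comp φ hφ
  map_vert {p q} h := by
    have := Span.hle_map φ hφ h
    induction p using GObj.ind with | _ m
    induction q using GObj.ind with | _ n
    exact this
  map_cell h := Span.hle_map φ hφ h

/-- The double functor `G(K)` induced by a functor `K`: it is given by `[m] ↦ [K m]` and
`[m, n] ↦ [K m, K n]`. -/
noncomputable def GFunctor (K : C ⥤ D) : DoubleFunctor (GObj C) (GObj D) :=
  GObj.mapDoubleFunctor (F := K) (o := K.obj) (fun m => K.map m) (fun h m => K.map_comp h m)

/-- The double functor `T` associated with a natural transformation `θ : K ⟶ K'`: it is given by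
`[m] ↦ [K' m ∘ θ]` and `[m, n] ↦ [K' m ∘ θ, K' n ∘ θ]`. -/
noncomputable def GTwist {K K' : C ⥤ D} (θ : K ⟶ K') : DoubleFunctor (GObj C) (GObj D) :=
  GObj.mapDoubleFunctor (F := K) (o := K'.obj) (fun {A _} m => θ.app A ≫ K'.map m)
    (fun h m => by simp)

/-- The horizontal arrow `[K m, K' m ∘ θ] : [K m] ⟶ [K' m ∘ θ]`. -/
def GTwist.app {K K' : C ⥤ D} (θ : K ⟶ K') (p : GObj C) :
    (GFunctor K).obj p ⟶ (GTwist θ).obj p :=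
  GHom.mk (Subobject.lift (fun A m _ => Span.mk (K.map m) (θ.app A ≫ K'.map m))
      (fun _ _ _ _ _ _ i h => Span.mk_eq_mk.2
        ⟨K.mapIso i, by simp [← K.map_comp, h], by simp [← h]⟩) p.sub :
      Span (K.obj p.base) (K'.obj p.base))
    (by
      induction p using GObj.ind with | _ m
      rfl)
    (by
      induction p using GObj.ind with | _ m
      rfl)

theorem GObj.objLE_mk' {A A' B : C} {m : A ⟶ B} {m' : A' ⟶ B} (i : A ⟶ A') (h : i ≫ m' = m) :
    ObjLE (GObj.mk' m) (GObj.mk' m') := Span.hle_mk i h h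

theorem GObj.objLE_ind {P : ∀ (p q : GObj C), Prop}
    (h : ∀ {A A' B : C} (i : A ⟶ A') (m : A' ⟶ B), P (GObj.mk' (i ≫ m)) (GObj.mk' m))
    {p q : GObj C} (hpq : ObjLE p q) : P p q := by
  induction p using GObj.ind with | _ m
  induction q using GObj.ind with | _ n
  obtain ⟨rfl, _, i, h₁, _⟩ := Span.hle_cases (m := m) (n := m) (m' := n) (n' := n) hpq
  rw [heq_iff_eq] at h₁
  subst h₁
  exact h i n

/-- The `Λ`-transformation `G(θ)` with components `[K m] ⟶ [K' m ∘ θ] ≤ [K' m]`. -/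
noncomputable def GNatTrans {K K' : C ⥤ D} (θ : K ⟶ K') :
    LambdaTrans (⟨GFunctor K⟩ : LCat (DoubleFunctor (GObj C) (GObj D))) ⟨GFunctor K'⟩ where
  mid := GTwist θ
  hor :=
    { app := GTwist.app θ
      cell := fun {p q} h => by
        refine GObj.objLE_ind (P := fun p q => GTwist.app θ p ⊑ GTwist.app θ q) ?_ h
        intro A A' B i m
        have e : K.map i ≫ θ.app A' ≫ K'.map m = θ.app A ≫ K'.map (i ≫ m) := by
          rw [K'.map_comp, θ.naturality_assoc]
        exact Span.hle_mk (K.map i) (K.map_comp i m).symm e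
      naturality := fun {p q} f => by
        refine GObj.hom_ind (P := fun {p q} f => (GFunctor K).map f ≫ GTwist.app θ q =
          GTwist.app θ p ≫ (GTwist θ).map f) ?_ f
        intro A B E m n
        exact (GObj.hom_comp (K.map m) (K.map n) (θ.app A ≫ K'.map n)).trans
          (GObj.hom_comp (K.map m) (θ.app A ≫ K'.map m) (θ.app A ≫ K'.map n)).symm }
  mid_le := DblCat.objLE_iff.2
    { app := fun p => by
        induction p using GObj.ind with | _ m
        exact GObj.objLE_mk' (θ.app _) rfl
      cell := fun f => by
        refine GObj.hom_ind (P := fun f => (GTwist θ).map f ⊑ (GFunctor K').map f) ?_ f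
        intro A B E m n
        exact Span.hle_mk (θ.app A) rfl rfl }

end GFunctor

theorem GFunctor_id {C : Type u} [Category.{v} C] [LeftCancellative C] :
    GFunctor (𝟭 C) = DoubleFunctor.id (GObj C) :=
  DoubleFunctor.ext_le
    (fun p => by
      induction p using GObj.ind with | _ m
      rfl)
    (fun f => GObj.hom_ind (P := fun f => (GFunctor (𝟭 C)).map f ⊑ f) (fun _ _ => le_refl _) f)

theorem GFunctor_comp {C D E : Type u} [Category.{v} C] [LeftCancellative C] [Category.{v} D]
    [LeftCancellative D] [Category.{v} E] [LeftCancellative E] (K : C ⥤ D) (M : D ⥤ E) :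
    GFunctor (K ⋙ M) = (GFunctor K).comp (GFunctor M) :=
  DoubleFunctor.ext_le
    (fun p => by
      induction p using GObj.ind with | _ m
      rfl)
    (fun f => GObj.hom_ind
      (P := fun f => (GFunctor (K ⋙ M)).map f ⊑ (GFunctor M).map ((GFunctor K).map f))
      (fun _ _ => le_refl _) f)

/-- The object of the 2-category of ordered groupoids given by an ordered groupoid. -/
abbrev OGpd.of (G : Type u) [OrderedGroupoid.{u} G] : OGpd.{u} := ⟨G⟩

/-- The 1-cell given by a double functor. -/
abbrev OGpd.ofDoubleFunctor {G H : OGpd.{u}} (F : DoubleFunctor G.carrier H.carrier) : G ⟶ H :=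
  LCat.mk F

/-- The double functor underlying a 1-cell. -/
abbrev OGpd.doubleFunctor {G H : OGpd.{u}} (F : G ⟶ H) : DoubleFunctor G.carrier H.carrier :=
  LCat.as F

theorem OGpd.hom₂_ext {G H : OGpd.{u}} {F K F' K' : G ⟶ H} (hF : F = F') (hK : K' = K)
    {α : F ⟶ K} {β : F' ⟶ K'}
    (h : ∀ X : G.carrier, (LambdaTrans.app α X).hor ⊑ (LambdaTrans.app β X).hor) :
    α = eqToHom hF ≫ β ≫ eqToHom hK := by
  subst hF hK
  rw [eqToHom_refl, eqToHom_refl, Category.id_comp, Category.comp_id]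
  exact LambdaTrans.ext fun X => LCat.hom_ext (h X)

theorem GNatTrans_id {C D : Type u} [Category.{v} C] [LeftCancellative C] [Category.{v} D]
    [LeftCancellative D] (K : C ⥤ D) :
    GNatTrans (𝟙 K) = 𝟙 (⟨GFunctor K⟩ : LCat (DoubleFunctor (GObj C) (GObj D))) := by
  refine LambdaTrans.ext fun p => LCat.hom_ext ?_
  induction p using GObj.ind with | _ m
  have e : 𝟙 _ ≫ K.map m = 𝟙 (K.obj _) ≫ K.map m := rfl
  exact Span.hle_mk (𝟙 _) (Category.id_comp _) e

theorem GNatTrans_comp {C D : Type u} [Category.{v} C] [LeftCancellative C] [Category.{v} D]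
    [LeftCancellative D] {K K' K'' : C ⥤ D} (θ : K ⟶ K') (θ' : K' ⟶ K'') :
    GNatTrans (θ ≫ θ') = GNatTrans θ ≫ GNatTrans θ' := by
  refine LambdaTrans.ext fun p => LCat.hom_ext ?_
  rw [LambdaTrans.comp_app]
  induction p using GObj.ind with | _ m
  refine le_symm (le_trans (LCat.comp_hor_le _ _
    (k := GObj.hom (θ.app _ ≫ K'.map m) (θ.app _ ≫ θ'.app _ ≫ K''.map m))
    (Span.hle_mk (θ.app _) rfl rfl)) ?_)
  refine le_trans (Y' := GObj.mk' (θ.app _ ≫ θ'.app _ ≫ K''.map m))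
    (g := GObj.hom (K.map m) (θ.app _ ≫ θ'.app _ ≫ K''.map m)) ?_ ?_
  · have := GObj.hom_comp (K.map m) (θ.app _ ≫ K'.map m) (θ.app _ ≫ θ'.app _ ≫ K''.map m)
    rw [← this]
    exact le_refl _
  · have e : 𝟙 (K.obj _) ≫ (θ ≫ θ').app _ ≫ K''.map m = θ.app _ ≫ θ'.app _ ≫ K''.map m := by
      simp
    exact Span.hle_mk (𝟙 _) (Category.id_comp _) e

/-- The 2-functor `G`. -/
noncomputable def G : StrictPseudofunctor LCCat.{u} OGpd.{u} :=
  StrictPseudofunctor.mk''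
    { obj := fun C => OGpd.of (GObj C.cat)
      map := fun K => OGpd.ofDoubleFunctor (GFunctor (LCCat.functor K))
      map₂ := fun θ => GNatTrans (LCCat.natTrans θ)
      map₂_id := fun K => GNatTrans_id (LCCat.functor K)
      map₂_comp := fun θ θ' => GNatTrans_comp (LCCat.natTrans θ) (LCCat.natTrans θ')
      map_id := fun C => congrArg LCat.mk GFunctor_id
      map_comp := fun K M =>
        congrArg LCat.mk (GFunctor_comp (LCCat.functor K) (LCCat.functor M))
      map₂_whisker_left := fun {C D E} K M M' θ => by
        refine OGpd.hom₂_ext (G := OGpd.of (GObj C.cat)) (H := OGpd.of (GObj E.cat))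
          (α := GNatTrans (LCCat.natTrans (K ◁ θ))) _ _ fun p => ?_
        induction p using GObj.ind with | _ m
        exact le_refl (GObj.hom ((LCCat.functor M).map ((LCCat.functor K).map m))
          ((LCCat.natTrans θ).app _ ≫ (LCCat.functor M').map ((LCCat.functor K).map m)))
      map₂_whisker_right := fun {C D E} K K' θ M => by
        refine OGpd.hom₂_ext (G := OGpd.of (GObj C.cat)) (H := OGpd.of (GObj E.cat))
          (α := GNatTrans (LCCat.natTrans (θ ▷ M))) _ _ fun p => ?_
        induction p using GObj.ind with | _ m
        have e : 𝟙 _ ≫ (LCCat.functor M).map ((LCCat.natTrans θ).app _ ≫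
              (LCCat.functor K').map m) =
            (LCCat.functor M).map ((LCCat.natTrans θ).app _) ≫
              (LCCat.functor M).map ((LCCat.functor K').map m) := by simp
        exact Span.hle_mk (𝟙 _) (Category.id_comp _) e }

/-! ### The unit and the counit -/

/-- The functor `η_C : C ⥤ L(G(C))`, sending `A` to `[1_A]` and `h : A ⟶ B` to
`[1_A] ⟶ [h] ≤ [1_B]`. -/
noncomputable def etaFunctor (C : Type u) [Category.{v} C] [LeftCancellative C] :
    C ⥤ LCat (GObj C) where
  obj A := ⟨GObj.mk' (𝟙 A)⟩
  map {A B} h := ⟨GObj.mk' h, GObj.hom (𝟙 A) h, GObj.objLE_mk' h (Category.comp_id h)⟩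
  map_id A := LCat.hom_ext (le_refl (GObj.hom (𝟙 A) (𝟙 A)))
  map_comp {A B D} h k := LCat.hom_ext (by
    refine le_symm (le_trans (LCat.comp_hor_le _ _ (k := GObj.hom h (h ≫ k))
      (Span.hle_mk h (Category.comp_id h) rfl)) ?_)
    have := GObj.hom_comp (𝟙 A) h (h ≫ k)
    rw [this]
    exact le_refl _)

section Kappa

variable {H : Type u} [OrderedGroupoid.{u} H]

theorem LCat.mid_le_mid {A A' B : LCat H} {m : A ⟶ B} {m' : A' ⟶ B} {h : A ⟶ A'}
    (e : h ≫ m' = m) : ObjLE m.mid m'.mid := by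
  subst e
  exact le_cod (res_le m'.hor h.mid_le)

theorem LCat.inv_comp_le {A A' B D : LCat H} {m : A ⟶ B} {n : A ⟶ D} {m' : A' ⟶ B} {n' : A' ⟶ D}
    {h : A ⟶ A'} (e : h ≫ m' = m) (e' : h ≫ n' = n) :
    Groupoid.inv m.hor ≫ n.hor ⊑ Groupoid.inv m'.hor ≫ n'.hor := by
  subst e e'
  rw [LCat.comp_hor, LCat.comp_hor]
  have : Groupoid.inv (h.hor ≫ res m'.hor h.mid_le) ≫ h.hor ≫ res n'.hor h.mid_le =
      Groupoid.inv (res m'.hor h.mid_le) ≫ res n'.hor h.mid_le := by simp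
  rw [this]
  exact le_comp (le_inv (res_le _ _)) (res_le _ _)

/-- The object part of `κ`: it sends the subobject `[A ⟶ B' ≤ B]` to `B'`. -/
noncomputable def kappaObj (p : GObj (LCat H)) : H :=
  Subobject.lift (fun (A : LCat H) (m : A ⟶ p.base) _ => LHom.mid m)
    (fun _ _ _ _ _ _ i h => (LCat.mid_le_mid h).antisymm
      (LCat.mid_le_mid (h := i.inv) (by rw [← h, Iso.inv_hom_id_assoc]))) p.sub

theorem exists_kappaHom {p q : GObj (LCat H)} (f : p ⟶ q) :
    ∃! k : kappaObj p ⟶ kappaObj q, ∃ (A : LCat H) (m : A ⟶ p.base) (n : A ⟶ q.base),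
      f.span = Span.mk m n ∧ k ⊑ Groupoid.inv m.hor ≫ n.hor := by
  refine GObj.hom_ind (P := fun {p q} f =>
    ∃! k : kappaObj p ⟶ kappaObj q, ∃ (A : LCat H) (m : A ⟶ p.base) (n : A ⟶ q.base),
      f.span = Span.mk m n ∧ k ⊑ Groupoid.inv m.hor ≫ n.hor) ?_ f
  intro A B D m n
  refine ⟨(Groupoid.inv m.hor ≫ n.hor : m.mid ⟶ n.mid), ⟨A, m, n, rfl, le_refl _⟩, ?_⟩
  rintro k ⟨A', m', n', h, hk⟩
  obtain ⟨i, h₁, h₂⟩ := Span.mk_eq_mk.1 h.symm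
  exact eq_of_le (le_trans hk (LCat.inv_comp_le h₁ h₂))

/-- The action of `κ` on horizontal arrows: it sends the class of a span with legs
`A ⟶ B' ≤ B` and `A ⟶ C' ≤ C` to the composite `B' ⟶ A ⟶ C'`. -/
noncomputable def kappaHom {p q : GObj (LCat H)} (f : p ⟶ q) : kappaObj p ⟶ kappaObj q :=
  (exists_kappaHom f).choose

theorem kappaHom_hom {A B D : LCat H} (m : A ⟶ B) (n : A ⟶ D) :
    kappaHom (GObj.hom m n) = (Groupoid.inv m.hor ≫ n.hor : m.mid ⟶ n.mid) :=
  ((exists_kappaHom (GObj.hom m n)).choose_spec.2 _ ⟨A, m, n, rfl, le_refl _⟩).symm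

theorem kappaHom_le {p q p' q' : GObj (LCat H)} {f : p ⟶ q} {g : p' ⟶ q'} (h : f ⊑ g) :
    kappaHom f ⊑ kappaHom g := by
  revert h
  refine GObj.hom_ind (P := fun f => f ⊑ g → kappaHom f ⊑ kappaHom g) ?_ f
  intro A B D m n
  refine GObj.hom_ind (P := fun g => GObj.hom m n ⊑ g → kappaHom (GObj.hom m n) ⊑ kappaHom g) ?_ g
  intro A' B' D' m' n' h
  obtain ⟨rfl, rfl, i, h₁, h₂⟩ := Span.hle_cases (m := m) (n := n) (m' := m') (n' := n') h
  rw [kappaHom_hom, kappaHom_hom]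
  exact LCat.inv_comp_le (eq_of_heq h₁) (eq_of_heq h₂)

theorem kappaHom_id (p : GObj (LCat H)) : kappaHom (𝟙 p) = 𝟙 (kappaObj p) := by
  induction p using GObj.ind with | _ m
  exact (kappaHom_hom m m).trans (Groupoid.inv_comp m.hor)

theorem kappaHom_comp {p q r : GObj (LCat H)} (f : p ⟶ q) (g : q ⟶ r) :
    kappaHom (f ≫ g) = kappaHom f ≫ kappaHom g := by
  refine GObj.hom_ind (P := fun {p q} f => ∀ g : q ⟶ r,
    kappaHom (f ≫ g) = kappaHom f ≫ kappaHom g) ?_ f g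
  intro A B D k m g
  refine GHom.ind_left m (P := fun {r} (g : GObj.mk' m ⟶ r) =>
    kappaHom (GObj.hom k m ≫ g) = kappaHom (GObj.hom k m) ≫ kappaHom g) ?_ g
  intro E n
  refine (congrArg kappaHom (GObj.hom_comp k m n)).trans ?_
  refine (kappaHom_hom k n).trans (Eq.trans ?_
    (congrArg₂ (· ≫ ·) (kappaHom_hom k m) (kappaHom_hom m n)).symm)
  have key : ∀ {a b c d : H} (x : a ⟶ b) (y : a ⟶ c) (z : a ⟶ d),
      Groupoid.inv x ≫ z = (Groupoid.inv x ≫ y) ≫ Groupoid.inv y ≫ z := by simp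
  exact key k.hor m.hor n.hor

variable (H) in
/-- The double functor `κ : G(L(H)) ⟶ H`. -/
noncomputable def kappaDoubleFunctor : DoubleFunctor (GObj (LCat H)) H where
  obj := kappaObj
  map := kappaHom
  map_id := kappaHom_id
  map_comp := kappaHom_comp
  map_vert {p q} h := by
    have := kappaHom_le h
    rwa [kappaHom_id, kappaHom_id] at this
  map_cell := kappaHom_le

end Kappa

/-- The component at `C` of the unit, as a 1-cell. -/
noncomputable def eta (C : LCCat.{u}) : C ⟶ L.obj (G.obj C) :=
  LCCat.ofFunctor (D := LCCat.of (LCat (GObj C.cat))) (etaFunctor C.cat)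

/-- The component at `H` of the counit, as a 1-cell. -/
noncomputable def kappa (H : OGpd.{u}) : G.obj (L.obj H) ⟶ H :=
  OGpd.ofDoubleFunctor (G := OGpd.of (GObj (LCat H.carrier))) (kappaDoubleFunctor H.carrier)

/-! ### Strict 2-natural transformations and 2-adjunctions -/

universe w₁ w₂ v₁ v₂ u₁ u₂

/-- A (strict) 2-natural transformation between 2-functors of 2-categories: the naturality squares
commute on the nose, and the components are natural with respect to 2-cells. -/
structure TwoNatTrans {B : Type u₁} [Bicategory.{w₁, v₁} B] [Bicategory.Strict B]
    {C : Type u₂} [Bicategory.{w₂, v₂} C] [Bicategory.Strict C]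
    (F K : StrictPseudofunctor B C) where
  app : ∀ a : B, F.obj a ⟶ K.obj a
  naturality : ∀ {a b : B} (f : a ⟶ b), F.map f ≫ app b = app a ≫ K.map f
  naturality₂ : ∀ {a b : B} {f g : a ⟶ b} (θ : f ⟶ g),
    F.map₂ θ ▷ app b = eqToHom (naturality f) ≫ app a ◁ K.map₂ θ ≫ eqToHom (naturality g).symm

/-- A (strict) 2-adjunction between 2-categories, with left adjoint `F` and right adjoint `U`: a
2-natural unit `Id ⟶ U F` and a 2-natural counit `F U ⟶ Id` which satisfy the triangle identities on
the nose. -/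
structure TwoAdjunction {B : Type u₁} [Bicategory.{w₁, v₁} B] [Bicategory.Strict B]
    {C : Type u₂} [Bicategory.{w₂, v₂} C] [Bicategory.Strict C]
    (F : StrictPseudofunctor B C) (U : StrictPseudofunctor C B) where
  unit : TwoNatTrans (StrictPseudofunctor.id B) (F.comp U)
  counit : TwoNatTrans (U.comp F) (StrictPseudofunctor.id C)
  left_triangle : ∀ b : B, F.map (unit.app b) ≫ counit.app (F.obj b) = 𝟙 (F.obj b)
  right_triangle : ∀ c : C, unit.app (U.obj c) ≫ U.map (counit.app c) = 𝟙 (U.obj c)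

end OrdGpd

namespace OrdGpd

/-! The 2-functors, the functors `η_C` and the double functors `κ_H` are already available, so what
remains is a list of equations: naturality of `η` and `κ` in 1-cells, naturality in 2-cells, and the
two triangles. Each becomes a one-line calculation once the equality to be proved is replaced by a
double cell.

The reduction rests on uniqueness of restrictions: two arrows of an ordered groupoid with the same
domain that are related by `⊑` have the same codomain and are equal. An arrow `(h, ≤)` of `L(H)` is
therefore determined by `h` up to `⊑`, and two double functors agreeing on objects are equal as soon
as one lies below the other on arrows (`DoubleFunctor.ext_le`). Since `⊑` relates arrows with
arbitrary endpoints, equations whose two sides live over different but equal objects need no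
transport.

For the unit, both composites send `A` to `[1_{KA}] = [K 1_A]` and `h` to the class with legs
`1_{KA} = K 1_A` and `K h`, because `K` preserves identities. For a 2-cell `θ`, the horizontal part
of `η(θ_A)` is `[1, θ_A]`, which is the horizontal part of `G(θ)` at `[1_A]` for the same reason
(`GNatTrans_app_eta`).

For the counit, `κ` sends `[m, n]` to the inverse of the horizontal part of `m` followed by that of
`n`, and double functors preserve inverses and composites. The least immediate point is naturality
in a `Λ`-transformation (`kappaHom_GNatTrans_app`): the naturality square of its horizontal part has
to be used.

The triangles amount to `[m, 1] ≫ [1, n] = [m, n]` in `G(C)` and to `1⁻¹ ≫ f = f` in `H`. -/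

/-! ### Equality criteria for functors and 2-cells with values in `L(G)`. -/

theorem LCat.hom_heq {G : Type u} [OrderedGroupoid.{v} G] {A B A' B' : LCat G} (hA : A = A')
    (hB : B = B') {f : A ⟶ B} {g : A' ⟶ B'} (h : f.hor ⊑ g.hor) : f ≍ g := by
  subst hA hB
  exact heq_of_eq (LCat.hom_ext h)

/-- The analogue of `DoubleFunctor.ext_le` for functors into `L(G)`. The intermediate objects of
`F.map f` and `K.map f` need not be compared: once the domains agree, the double cell between the
horizontal parts forces them to coincide. -/
theorem LCat.functor_ext {C : Type*} [Category* C] {G : Type u} [OrderedGroupoid.{v} G]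
    {F K : C ⥤ LCat G} (hobj : ∀ X, F.obj X = K.obj X)
    (h : ∀ {X Y : C} (f : X ⟶ Y), (F.map f).hor ⊑ (K.map f).hor) : F = K :=
  CategoryTheory.Functor.hext hobj fun X Y f => LCat.hom_heq (hobj X) (hobj Y) (h f)

/-- Equality of 2-cells of `LCCat` with values in `L(H)` can be checked on the horizontal parts of
the components. -/
theorem LCCat.hom₂_ext_hor {C : LCCat.{u}} {H : Type u} [OrderedGroupoid.{u} H]
    {F K F' K' : C ⟶ LCCat.of (LCat H)} (hF : F = F') (hK : K' = K) {α : F ⟶ K} {β : F' ⟶ K'}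
    (h : ∀ X : C.cat, LHom.hor (C := H) ((LCCat.natTrans α).app X) ⊑
      LHom.hor (C := H) ((LCCat.natTrans β).app X)) :
    α = eqToHom hF ≫ β ≫ eqToHom hK := by
  -- After the boundary 1-cells are identified, both `eqToHom` are identities, and the claim is an
  -- equality of parallel 2-cells, checked componentwise.
  subst hF hK
  rw [eqToHom_refl, eqToHom_refl, Category.id_comp, Category.comp_id]
  exact LCCat.hom₂_ext fun X => LCat.hom_ext (h X)

/-! ### Naturality of the unit -/

section Eta

variable {C D : Type u} [Category.{v} C] [LeftCancellative C] [Category.{v} D]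
  [LeftCancellative D]

/-- Replacing a leg by an equal one changes the objects `[m]`, `[n]` and hence the type of the
arrow, so the comparison is stated with `⊑` instead of `=`. -/
theorem GObj.hom_le_of_eq {A B E : C} {m m' : A ⟶ B} {n n' : A ⟶ E} (h : m = m') (h' : n = n') :
    GObj.hom m n ⊑ GObj.hom m' n' := by
  subst h h'; exact le_refl _

/-- The two sides differ only in writing `1_{KA}` or `K 1_A`, both in the object `[1_{KA}]` and in
the left leg of the span attached to `h`; the right leg is `K h` on both sides. -/
theorem etaFunctor_naturality (K : C ⥤ D) :
    K ⋙ etaFunctor D = etaFunctor C ⋙ LFunctor (GFunctor K) :=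
  LCat.functor_ext
    (fun A => congrArg (fun m => (⟨GObj.mk' m⟩ : LCat (GObj D))) (K.map_id A).symm)
    (fun {A _} h => GObj.hom_le_of_eq (K.map_id A).symm (rfl : K.map h = K.map h))

/-- This is naturality of `η` in 2-cells, read at `A`: whiskering `θ` with `η` gives `η(θ_A)`, while
whiskering `LG(θ)` with `η` evaluates `G(θ)` at the object `[1_A]`. -/
theorem GNatTrans_app_eta {K K' : C ⥤ D} (θ : K ⟶ K') (A : C) :
    LHom.hor ((etaFunctor D).map (θ.app A)) ⊑
      ((GNatTrans θ).app (GObj.mk' (𝟙 A))).hor :=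
  -- These legs are the general component `[K m, K' m ∘ θ_A]` of `G(θ)` with `m = 1_A`.
  GObj.hom_le_of_eq (m' := K.map (𝟙 A)) (n' := θ.app A ≫ K'.map (𝟙 A))
    (K.map_id A).symm (by simp)

/-- On objects, `η` sends `m` to an arrow whose intermediate object is `[m]`, and `κ` returns that
intermediate object. On arrows, `[m, n]` goes to the inverse of `[1_A, m]` followed by `[1_A, n]`.
-/
theorem etaFunctor_triangle (C : Type u) [Category.{u} C] [LeftCancellative C] :
    (GFunctor (etaFunctor C)).comp (kappaDoubleFunctor (GObj C)) = DoubleFunctor.id (GObj C) :=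
  DoubleFunctor.ext_le
    (fun p => by
      induction p using GObj.ind with | _ m
      rfl)
    (fun f => by
      refine GObj.hom_ind (P := fun f =>
        kappaHom ((GFunctor (etaFunctor C)).map f) ⊑ f) ?_ f
      intro A B E m n
      have h₁ := kappaHom_hom ((etaFunctor C).map m) ((etaFunctor C).map n)
      -- Inversion in `G(C)` swaps the legs, so the inverse of `[1_A, m]` is `[m, 1_A]` by
      -- definition and the composite is `[m, n]`.
      have h₂ := GObj.hom_comp m (𝟙 A) n
      exact (congrArg (fun k => k ⊑ GObj.hom m n) (h₁.trans h₂)).mpr (le_refl _))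

end Eta

/-! ### Naturality of the counit -/

section Kappa

variable {G H : Type u} [OrderedGroupoid.{u} G] [OrderedGroupoid.{u} H]

/-- `L(F)` applies `F` separately to the intermediate object and to the horizontal part, so the
object parts agree by definition; on arrows the point is that `F` commutes with `k ∘ h⁻¹`. -/
theorem kappaDoubleFunctor_naturality (F : DoubleFunctor G H) :
    (GFunctor (LFunctor F)).comp (kappaDoubleFunctor H) = (kappaDoubleFunctor G).comp F :=
  DoubleFunctor.ext_le
    (fun p => by
      induction p using GObj.ind with | _ m
      rfl)
    (fun f => by
      refine GObj.hom_ind (P := fun f =>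
        kappaHom ((GFunctor (LFunctor F)).map f) ⊑ F.map (kappaHom f)) ?_ f
      intro A B E m n
      have h₁ := kappaHom_hom ((LFunctor F).map m) ((LFunctor F).map n)
      have h₂ : F.map (kappaHom (GObj.hom m n)) =
          Groupoid.inv (F.map m.hor) ≫ F.map n.hor := by
        have e : ∀ {a b c : G} (x : a ⟶ b) (y : a ⟶ c),
            F.map (Groupoid.inv x ≫ y) = Groupoid.inv (F.map x) ≫ F.map y := by simp
        rw [kappaHom_hom]
        exact e m.hor n.hor
      exact (congrArg₂ (fun k l : F.obj m.mid ⟶ F.obj n.mid => k ⊑ l) h₁ h₂).mpr (le_refl _))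

/-- This is naturality of `κ` in 2-cells at `p = [m]`. The left side unfolds to `F(m)⁻¹` followed by
the horizontal part of `K(m) ∘ α_A`; naturality of `α` rewrites the latter as `α ∘ F(m)`, with `α`
taken at the intermediate object of `m`, which is `κ[m]`. -/
theorem kappaHom_GNatTrans_app {F K : LCat (DoubleFunctor G H)} (α : LambdaTrans F K)
    (p : GObj (LCat G)) :
    kappaHom ((GNatTrans (LNatTrans α)).app p).hor ⊑ (α.app (kappaObj p)).hor := by
  induction p using GObj.ind with | _ m
  rename_i A B
  have h₁ := kappaHom_hom ((LFunctor F.as).map m) (α.app A.as ≫ (LFunctor K.as).map m)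
  -- Composition in `L(H)` restricts `K(m)` to the intermediate double functor of `α`. As `α.mid ≤
  -- K`, this restriction is `α.mid.map m.hor`, exactly the side of the naturality square of `α.hor`
  -- that is needed.
  have h₂ : (α.app A.as ≫ (LFunctor K.as).map m).hor ⊑ F.as.map m.hor ≫ α.hor.app m.mid := by
    refine le_trans (LCat.comp_hor_le (α.app A.as) ((LFunctor K.as).map m)
      (α.mid_le.left.cell m.hor)) ?_
    exact (congrArg (fun k => k ⊑ F.as.map m.hor ≫ α.hor.app m.mid)
      (α.hor.naturality m.hor)).mp (le_refl _)
  -- Precomposing with `F(m)⁻¹` cancels `F(m)` and leaves the component of `α.hor` at `m.mid`.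
  have h₃ := le_comp (le_refl (Groupoid.inv (F.as.map m.hor))) h₂
  rw [← Category.assoc, Groupoid.inv_comp, Category.id_comp] at h₃
  exact le_trans ((congrArg (fun k => k ⊑ _) h₁).mpr (le_refl _)) h₃

/-- `η` sends `f` to an arrow with horizontal part `[1_A, f]`, and `κ` turns this into `1⁻¹ ≫
f.hor`, since the identity of `A` in `L(H)` has identity horizontal part. -/
theorem kappaDoubleFunctor_triangle (H : Type u) [OrderedGroupoid.{u} H] :
    etaFunctor (LCat H) ⋙ LFunctor (kappaDoubleFunctor H) = 𝟭 (LCat H) :=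
  LCat.functor_ext (fun _ => rfl) (fun {A B} f => by
    have h₁ := kappaHom_hom (𝟙 A) f
    have h₂ : Groupoid.inv (𝟙 A : A ⟶ A).hor ≫ f.hor = f.hor := by
      have e : ∀ {a b : H} (x : a ⟶ b), Groupoid.inv (𝟙 a) ≫ x = x := by simp
      exact e f.hor
    exact (congrArg (fun k => k ⊑ f.hor) (h₁.trans h₂)).mpr (le_refl _))

end Kappa

/-! ### Assembly of the 2-adjunction. -/

/-- The 2-natural unit `η : Id ⟶ L G`. -/
noncomputable def etaTwoNatTrans : TwoNatTrans (StrictPseudofunctor.id LCCat.{u}) (G.comp L) where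
  app := eta
  naturality K := LCCat.hom_ext (etaFunctor_naturality (LCCat.functor K))
  naturality₂ {_ D _ _} θ :=
    LCCat.hom₂_ext_hor (H := GObj D.cat) _ _ (GNatTrans_app_eta (LCCat.natTrans θ))

/-- The 2-natural counit `κ : G L ⟶ Id`. -/
noncomputable def kappaTwoNatTrans : TwoNatTrans (L.comp G) (StrictPseudofunctor.id OGpd.{u}) where
  app := kappa
  naturality F := congrArg LCat.mk (kappaDoubleFunctor_naturality (OGpd.doubleFunctor F))
  naturality₂ {G H _ _} α :=
    OGpd.hom₂_ext (G := OGpd.of (GObj (LCat G.carrier))) (H := H) _ _ (kappaHom_GNatTrans_app α)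

/-- The 2-adjunction between `G` and `L`, with unit `η` and counit `κ`. -/
noncomputable def twoAdjunction : TwoAdjunction G.{u} L.{u} where
  unit := etaTwoNatTrans
  counit := kappaTwoNatTrans
  left_triangle C := congrArg LCat.mk (etaFunctor_triangle C.cat)
  right_triangle H := LCCat.hom_ext (kappaDoubleFunctor_triangle H.carrier)

end OrdGpd

/-- All fields of `TwoAdjunction` other than the components of unit and counit are propositions, so
prescribing these components as `eta` and `kappa` pins down the adjunction. -/
theorem mainTheorem1 :
    ∃ adj : OrdGpd.TwoAdjunction OrdGpd.G.{u} OrdGpd.L.{u},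
      (∀ C : OrdGpd.LCCat.{u}, adj.unit.app C = OrdGpd.eta C) ∧
      (∀ H : OrdGpd.OGpd.{u}, adj.counit.app H = OrdGpd.kappa H) :=
  ⟨OrdGpd.twoAdjunction, fun _ => rfl, fun _ => rfl⟩
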